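/- Let $d\ge 1$, $A\ge 0$, $\sigma>0$. For a law $P^X$ on $\mathbb{R}^d$ and a regression function $m:\mathbb{R}^d\to\mathbb{R}$, consider the Fay–Herriot model $$X\sim P^X,\qquad \mu\mid X\sim N(m(X),A),\qquad Z\mid \mu\sim N(\mu,\sigma^2).$$ One observes $n$ i.i.d. copies $(X_i,Z_i)$, $1\le i\le n$, but not the $\mu_i$. A data-driven denoiser is a jointly measurable function $\hat t_n$ of the data and of a point $(x,z)\in\mathbb{R}^d\times\mathbb{R}$, used to estimate $\mu_{n+1}$ by $\hat t_n(X_{n+1},Z_{n+1})$ for an independent future triple $(X_{n+1},\mu_{n+1},Z_{n+1})$. The regret of a denoiser $t$ is $$L(t;P^X,m,A)=\mathbb{E}\big(t(X_{n+1},Z_{n+1})-\mu_{n+1}\big)^2-\mathbb{E}\big(t^*(X_{n+1},Z_{n+1})-\mu_{n+1}\big)^2\in[0,\infty],\qquad t^*(X_{n+1},Z_{n+1})=\mathbb{E}[\mu_{n+1}\mid X_{n+1},Z_{n+1}].$$ For a set $\mathcal P$ of covariate laws and the linear class $\mathrm{Lin}(\mathbb{R}^d)=\{x\mapsto x^\top\beta:\beta\in\mathbb{R}^d\}$,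 the minimax empirical Bayes regret is $$\mathfrak{M}_n(\mathcal P;A,\sigma^2)=\inf_{\hat t_n}\ \sup_{P^X\in\mathcal P}\ \sup_{m\in \mathrm{Lin}(\mathbb{R}^d)}\mathbb{E}\big[L(\hat t_n;P^X,m,A)\big],$$ where the infimum is over all data-driven denoisers (which may depend on $\mathcal P, A,\sigma, n$). Theorem. There is a universal constant $C<\infty$ (not depending on $d$, $\Sigma$, $A$, $\sigma$) such that for all $d\ge1$, $A\ge0$, $\sigma>0$ the following hold. (i) For every positive definite $\Sigma\in\mathbb{R}^{d\times d}$, with $\mathcal P=\{N(0,\Sigma)\}$, the limit $$\lim_{n\to\infty}\left|\log\left(\mathfrak{M}_n(\mathcal P;A,\sigma^2)\Big/\left(\frac{\sigma^4}{(\sigma^2+A)^2}\cdot\frac{(\sigma^2+A)\,d}{n}\right)\right)\right|$$ exists and is at most $C$. (ii) The same holds with $\mathcal P=\{N(0,\Sigma):\Sigma\succ0\}$, that is, when the covariance matrix is unknown to the denoiser. -/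

import Mathlib

open MeasureTheory ProbabilityTheory Filter
open scoped NNReal ENNReal Topology

namespace FayHerriot

noncomputable section

variable {𝒳 : Type*} [MeasurableSpace 𝒳]

/-- The joint law of `(X, μ, Z)` in the model
`X ∼ PX`, `μ ∣ X ∼ N(m(X), A)`, `Z ∣ μ ∼ N(μ, σ²)`. A variance zero gives a point mass. -/
def modelLaw (PX : Measure 𝒳) (m : 𝒳 → ℝ) (A σ : ℝ≥0) : Measure (𝒳 × ℝ × ℝ) :=
  PX.bind fun x => (gaussianReal (m x) A).bind fun u =>
    (gaussianReal u (σ ^ 2)).map fun z => (x, u, z)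

/-- The observed part `(X, Z)` of a triple `(X, μ, Z)`. -/
def obs (p : 𝒳 × ℝ × ℝ) : 𝒳 × ℝ := (p.1, p.2.2)

/-- The law of one observation `(X, Z)`. -/
def obsLaw (PX : Measure 𝒳) (m : 𝒳 → ℝ) (A σ : ℝ≥0) : Measure (𝒳 × ℝ) :=
  (modelLaw PX m A σ).map obs

/-- The law of the data, `n` i.i.d. observations `(X₁, Z₁), …, (Xₙ, Zₙ)`. -/
def dataLaw (PX : Measure 𝒳) (m : 𝒳 → ℝ) (A σ : ℝ≥0) (n : ℕ) :
    Measure (Fin n → 𝒳 × ℝ) :=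
  Measure.pi fun _ => obsLaw PX m A σ

/-- The oracle Bayes rule `t*(X, Z) = E[μ ∣ X, Z]`, as a random variable on triples `(X, μ, Z)`. -/
def bayesRule (PX : Measure 𝒳) (m : 𝒳 → ℝ) (A σ : ℝ≥0) : 𝒳 × ℝ × ℝ → ℝ :=
  (modelLaw PX m A σ)[fun p => p.2.1 | MeasurableSpace.comap obs inferInstance]

/-- The regret (excess risk) `E (t(X, Z) - μ)² - E (t*(X, Z) - μ)²` of a fixed denoiser `t`, with
value `∞` if the first term is infinite. As `t*` minimizes the mean squared error, the truncated
subtraction of `ℝ≥0∞` is an ordinary one for measurable `t` and square integrable `μ`. -/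
def regret (PX : Measure 𝒳) (m : 𝒳 → ℝ) (A σ : ℝ≥0) (t : 𝒳 × ℝ → ℝ) : ℝ≥0∞ :=
  (∫⁻ p, ENNReal.ofReal ((t (obs p) - p.2.1) ^ 2) ∂(modelLaw PX m A σ)) -
    ∫⁻ p, ENNReal.ofReal ((bayesRule PX m A σ p - p.2.1) ^ 2) ∂(modelLaw PX m A σ)

/-- The expected regret of a data-driven denoiser `t`, where `t D` is the denoiser built from the
data `D`; the future triple `(X, μ, Z)` is independent of the data. -/
def expectedRegret (PX : Measure 𝒳) (m : 𝒳 → ℝ) (A σ : ℝ≥0) (n : ℕ)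
    (t : (Fin n → 𝒳 × ℝ) → 𝒳 × ℝ → ℝ) : ℝ≥0∞ :=
  ∫⁻ D, regret PX m A σ (t D) ∂(dataLaw PX m A σ n)

/-- The minimax empirical Bayes regret: the infimum over all (jointly measurable) data-driven
denoisers of the worst expected regret over covariate laws in `laws` and regression functions in `𝒞`.
The denoiser may depend on `laws`, `𝒞`, `A`, `σ` and `n`, so `laws = {PX}` is the case in which the
covariate law `PX` is fixed. -/
def minimaxRegret (laws : Set (Measure 𝒳)) (𝒞 : Set (𝒳 → ℝ)) (A σ : ℝ≥0) (n : ℕ) : ℝ≥0∞ :=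
  ⨅ (t : (Fin n → 𝒳 × ℝ) → 𝒳 × ℝ → ℝ) (_ : Measurable (Function.uncurry t)),
    ⨆ PX ∈ laws, ⨆ m ∈ 𝒞, expectedRegret PX m A σ n t

/-- The linear class `{x ↦ xᵀβ ∣ β ∈ ℝᵈ}`. -/
def linearClass (d : ℕ) : Set (EuclideanSpace ℝ (Fin d) → ℝ) :=
  {m | ∃ β : EuclideanSpace ℝ (Fin d), m = fun x => inner ℝ x β}

/-- The rate `σ⁴ / (σ² + A)² · (σ² + A) d / n`. -/
def linearRate (d : ℕ) (A σ : ℝ≥0) (n : ℕ) : ℝ≥0 :=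
  σ ^ 4 / (σ ^ 2 + A) ^ 2 * ((σ ^ 2 + A) * d / n)

/-- `|log (a / b)|` in `[0, ∞]`; it is `∞` when `a = 0` or `a = ∞` and `0 < b < ∞`. -/
def absLogRatio (a : ℝ≥0∞) (b : ℝ≥0) : ℝ≥0∞ := (ENNReal.log (a / (b : ℝ≥0∞))).abs

/-- The joint law of `(X, μ, Z)` through independent noise: `μ = m(X) + e`, `Z = μ + w`. -/
theorem modelLaw_eq_map (PX : Measure 𝒳) [IsProbabilityMeasure PX] {m : 𝒳 → ℝ}
    (hm : Measurable m) (A σ : ℝ≥0) :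
    modelLaw PX m A σ = (PX.prod ((gaussianReal 0 A).prod (gaussianReal 0 (σ ^ 2)))).map
      fun q => (q.1, m q.1 + q.2.1, m q.1 + q.2.1 + q.2.2) := by
  have hF : Measurable fun q : 𝒳 × ℝ × ℝ => (q.1, m q.1 + q.2.1, m q.1 + q.2.1 + q.2.2) := by
    fun_prop
  have h1 : ∀ (x : 𝒳) (u : ℝ), (gaussianReal u (σ ^ 2)).map (fun z => (x, u, z)) =
      (gaussianReal 0 (σ ^ 2)).map (fun w => (x, u, u + w)) := by
    intro x u
    have h := gaussianReal_map_const_add (μ := 0) (v := σ ^ 2) u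
    rw [zero_add] at h
    rw [← h, Measure.map_map (by fun_prop) (by fun_prop)]
    rfl
  have hmeas1 : ∀ x : 𝒳, Measurable fun u : ℝ =>
      (gaussianReal 0 (σ ^ 2)).map (fun w => (x, u, u + w)) := by
    intro x
    refine Measure.measurable_of_measurable_coe _ fun s hs => ?_
    have : ∀ u : ℝ, (gaussianReal 0 (σ ^ 2)).map (fun w => (x, u, u + w)) s =
        gaussianReal 0 (σ ^ 2) (Prod.mk u ⁻¹' {q : ℝ × ℝ | (x, q.1, q.1 + q.2) ∈ s}) := by
      intro u
      rw [Measure.map_apply (by fun_prop) hs]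
      rfl
    simp_rw [this]
    exact measurable_measure_prodMk_left
      ((show Measurable fun q : ℝ × ℝ => (x, q.1, q.1 + q.2) by fun_prop) hs)
  have h2 : ∀ x : 𝒳, ((gaussianReal (m x) A).bind fun u =>
      (gaussianReal u (σ ^ 2)).map fun z => (x, u, z)) =
      ((gaussianReal 0 A).prod (gaussianReal 0 (σ ^ 2))).map
        fun r => (x, m x + r.1, m x + r.1 + r.2) := by
    intro x
    simp_rw [h1]
    have h := gaussianReal_map_const_add (μ := 0) (v := A) (m x)
    rw [zero_add] at h
    ext s hs
    have hg : Measurable fun u : ℝ =>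
        (gaussianReal 0 (σ ^ 2)).map (fun w => (x, u, u + w)) s :=
      (Measure.measurable_coe hs).comp (hmeas1 x)
    rw [Measure.bind_apply hs (hmeas1 x).aemeasurable, ← h,
      lintegral_map hg (by fun_prop),
      Measure.map_apply (by fun_prop) hs,
      Measure.prod_apply ((show Measurable fun r : ℝ × ℝ => (x, m x + r.1, m x + r.1 + r.2) by
        fun_prop) hs)]
    refine lintegral_congr fun e => ?_
    rw [Measure.map_apply (by fun_prop) hs]
    rfl
  have h3 : ∀ {s : Set (𝒳 × ℝ × ℝ)}, MeasurableSet s → ∀ x : 𝒳,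
      ((gaussianReal 0 A).prod (gaussianReal 0 (σ ^ 2))).map
        (fun r => (x, m x + r.1, m x + r.1 + r.2)) s =
      ((gaussianReal 0 A).prod (gaussianReal 0 (σ ^ 2))) (Prod.mk x ⁻¹'
        ((fun q : 𝒳 × ℝ × ℝ => (q.1, m q.1 + q.2.1, m q.1 + q.2.1 + q.2.2)) ⁻¹' s)) := by
    intro s hs x
    rw [Measure.map_apply (by fun_prop) hs]
    rfl
  unfold modelLaw
  simp_rw [h2]
  ext s hs
  rw [Measure.bind_apply hs, Measure.map_apply hF hs, Measure.prod_apply (hF hs)]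
  · exact lintegral_congr fun x => h3 hs x
  · refine (Measure.measurable_of_measurable_coe _ fun s hs => ?_).aemeasurable
    simp_rw [h3 hs]
    exact measurable_measure_prodMk_left (hF hs)

end

end FayHerriot

/-! Write `v = A + σ²`, `ρ = A / v` and `ε = Z - m(X)`, which is `N(0, v)`. The posterior error `μ -
E[μ ∣ X, Z]` is centred and independent of `(X, Z)`, so its variance cancels and the regret of `t`
is `E (t(X, Z) - m(X) - ρ ε)²` (`regret_eq_lintegral`). The problem becomes estimation of `(1 - ρ)
m(X₀)` in Gaussian linear regression with `n + 1` observed responses, the new point having index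
`0`.

Upper bound: plug in the least squares fit through all `n + 1` points. Its error at the new point is
`(1 - ρ) (Pε)₀`, with `P` the projection onto the column span. By exchangeability `E (Pε)₀² = E
‖Pε‖² / (n + 1) ≤ v d / (n + 1)`, so no Gram matrix is inverted and the covariance plays no role
(`lintegral_leastSquaresFit_zero_sq_le`).

Lower bound: whiten the covariates and put the prior `N(0, v I)` on the coefficients. Any linear
form uncorrelated with the observations certifies a lower bound for the Bayes risk
(`bayesRisk_linearForm_ge`). The form obtained by replacing the posterior covariance by `v I / n`
loses only a factor `1 - O(1/n)`.

The two bounds agree to first order, so the ratio to the rate tends to `1` and both limits are `0`.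
-/

namespace FayHerriot

/-! ### Linear forms in i.i.d. Gaussian coordinates and a dual bound for the Bayes risk. -/

section GaussianVectors

variable {ι κ : Type*} [Fintype ι] [Fintype κ]

/-- The law of a vector of i.i.d. centred Gaussian coordinates. -/
noncomputable abbrev iidGaussian (ι : Type*) [Fintype ι] (v : ℝ≥0) : Measure (ι → ℝ) :=
  Measure.pi fun _ => gaussianReal 0 v

theorem hasGaussianLaw_id_iidGaussian (v : ℝ≥0) :
    HasGaussianLaw (fun x : ι → ℝ => x) (iidGaussian ι v) := by
  have h : iIndepFun (fun (i : ι) (x : ι → ℝ) => x i) (iidGaussian ι v) :=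
    iIndepFun_pi (X := fun _ => id) fun _ => aemeasurable_id
  refine h.hasGaussianLaw fun i => ⟨?_⟩
  rw [(measurePreserving_eval (fun _ : ι => gaussianReal 0 v) i).map_eq]
  infer_instance

theorem memLp_linearForm (v : ℝ≥0) (a : ι → ℝ) :
    MemLp (fun x : ι → ℝ => ∑ i, a i * x i) 2 (iidGaussian ι v) := by
  refine memLp_finsetSum _ fun i _ => MemLp.const_mul ?_ _
  exact (memLp_id_gaussianReal 2).comp_measurePreserving
    (measurePreserving_eval (fun _ : ι => gaussianReal 0 v) i)

theorem integral_linearForm (v : ℝ≥0) (a : ι → ℝ) :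
    ∫ x, ∑ i, a i * x i ∂(iidGaussian ι v) = 0 := by
  rw [integral_finsetSum]
  · refine Finset.sum_eq_zero fun i _ => ?_
    rw [integral_const_mul, integral_eval (μ := fun _ : ι => gaussianReal 0 v)]
    simp
  · intro i _
    exact (((memLp_id_gaussianReal 2).comp_measurePreserving
      (measurePreserving_eval (fun _ : ι => gaussianReal 0 v) i)).integrable
        (by norm_num)).const_mul _

theorem integral_linearForm_sq (v : ℝ≥0) (a : ι → ℝ) :
    ∫ x, (∑ i, a i * x i) ^ 2 ∂(iidGaussian ι v) = v * ∑ i, a i ^ 2 := by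
  have h := variance_sum_pi (μ := fun _ : ι => gaussianReal 0 v) (X := fun i y => a i * y)
    (fun i => (memLp_id_gaussianReal 2).const_mul _)
  have h2 : (∑ i, fun x : ι → ℝ => a i * x i) = fun x => ∑ i, a i * x i := by
    ext; simp
  rw [h2, variance_of_integral_eq_zero (memLp_linearForm v a).aemeasurable
    (integral_linearForm v a)] at h
  rw [h, Finset.mul_sum]
  refine Finset.sum_congr rfl fun i _ => ?_
  rw [variance_const_mul]
  simp [variance_fun_id_gaussianReal, mul_comm]

theorem integral_linearForm_mul (v : ℝ≥0) (a b : ι → ℝ) :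
    ∫ x, (∑ i, a i * x i) * (∑ i, b i * x i) ∂(iidGaussian ι v) = v * ∑ i, a i * b i := by
  have h1 := integral_linearForm_sq v (a + b)
  have ha := memLp_linearForm v a
  have hb := memLp_linearForm v b
  have h2 : ∀ x : ι → ℝ, (∑ i, (a + b) i * x i) ^ 2 = (∑ i, a i * x i) ^ 2 +
      (∑ i, b i * x i) ^ 2 + 2 * ((∑ i, a i * x i) * (∑ i, b i * x i)) := by
    intro x
    simp only [Pi.add_apply, add_mul, Finset.sum_add_distrib]
    ring
  simp_rw [h2] at h1
  have i1 : Integrable (fun x : ι → ℝ => (∑ i, a i * x i) ^ 2 + (∑ i, b i * x i) ^ 2)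
      (iidGaussian ι v) := ha.integrable_sq.add hb.integrable_sq
  have i2 : Integrable (fun x : ι → ℝ => 2 * ((∑ i, a i * x i) * (∑ i, b i * x i)))
      (iidGaussian ι v) := (ha.integrable_mul hb).const_mul 2
  rw [integral_add i1 i2,
    integral_add ha.integrable_sq hb.integrable_sq, integral_linearForm_sq,
    integral_linearForm_sq, integral_const_mul] at h1
  have h3 : ∑ i, (a + b) i ^ 2 = ∑ i, a i ^ 2 + ∑ i, b i ^ 2 + 2 * ∑ i, a i * b i := by
    rw [Finset.mul_sum, ← Finset.sum_add_distrib, ← Finset.sum_add_distrib]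
    exact Finset.sum_congr rfl fun i _ => by simp only [Pi.add_apply]; ring
  rw [h3] at h1
  linarith

theorem lintegral_linearForm_sq (v : ℝ≥0) (a : ι → ℝ) :
    ∫⁻ x, ENNReal.ofReal ((∑ i, a i * x i) ^ 2) ∂(iidGaussian ι v) =
      ENNReal.ofReal (v * ∑ i, a i ^ 2) := by
  rw [← integral_linearForm_sq, ofReal_integral_eq_lintegral_ofReal
    (memLp_linearForm v a).integrable_sq (ae_of_all _ fun _ => sq_nonneg _)]

/-- The two families are jointly Gaussian as a continuous linear image of a Gaussian vector, and
orthogonal coefficients make them uncorrelated. The single form is indexed by `Unit` to fit the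
criterion for families. -/
theorem indepFun_linearForm (v : ℝ≥0) (c : ι → ℝ) (B : κ → ι → ℝ)
    (h : ∀ j, ∑ i, c i * B j i = 0) :
    IndepFun (fun (x : ι → ℝ) (_ : Unit) => ∑ i, c i * x i)
      (fun (x : ι → ℝ) (j : κ) => ∑ i, B j i * x i) (iidGaussian ι v) := by
  refine HasGaussianLaw.indepFun_of_covariance_eval (X := fun _ (x : ι → ℝ) => ∑ i, c i * x i)
    (Y := fun j (x : ι → ℝ) => ∑ i, B j i * x i) ?_ ?_
  · let L : (ι → ℝ) →L[ℝ] (Unit → ℝ) × (κ → ℝ) :=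
      (ContinuousLinearMap.pi fun _ => ∑ i, c i • ContinuousLinearMap.proj i).prod
        (ContinuousLinearMap.pi fun j => ∑ i, B j i • ContinuousLinearMap.proj i)
    have := (hasGaussianLaw_id_iidGaussian (ι := ι) v).map_fun L
    have e : (fun x : ι → ℝ => L x) = fun x : ι → ℝ =>
        ((fun _ : Unit => ∑ i, c i * x i), fun j : κ => ∑ i, B j i * x i) := by
      ext x <;> simp [L]
    rwa [e] at this
  · intro _ j
    rw [covariance_eq_sub (memLp_linearForm v c) (memLp_linearForm v (B j)), integral_linearForm]
    simp only [Pi.mul_apply]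
    rw [integral_linearForm_mul, h]
    simp

/-- A lower bound for the Bayes risk of estimating a linear form `∑ i, a i * x i` of a Gaussian
vector from linear forms uncorrelated with `∑ i, c i * x i`. -/
theorem bayesRisk_linearForm_ge (v : ℝ≥0) (a c : ι → ℝ) (B : κ → ι → ℝ)
    (h : ∀ j, ∑ i, c i * B j i = 0) {g : (κ → ℝ) → ℝ} (hg : Measurable g) :
    ENNReal.ofReal (v * (-2 * ∑ i, a i * c i - ∑ i, c i ^ 2)) ≤
      ∫⁻ x, ENNReal.ofReal ((g (fun j => ∑ i, B j i * x i) - ∑ i, a i * x i) ^ 2)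
        ∂(iidGaussian ι v) := by
  set Y : (ι → ℝ) → κ → ℝ := fun x j => ∑ i, B j i * x i
  have hY : Measurable Y := by fun_prop
  -- With infinite risk there is nothing to prove; otherwise the error, and hence `g (Y x)`, is
  -- square integrable.
  by_cases hfin : ∫⁻ x, ENNReal.ofReal ((g (Y x) - ∑ i, a i * x i) ^ 2) ∂(iidGaussian ι v) = ⊤
  · rw [hfin]; exact le_top
  have hm : Measurable fun x : ι → ℝ => g (Y x) - ∑ i, a i * x i := by fun_prop
  have hI : Integrable (fun x : ι → ℝ => (g (Y x) - ∑ i, a i * x i) ^ 2) (iidGaussian ι v) := by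
    refine ⟨(hm.pow_const 2).aestronglyMeasurable, ?_⟩
    rw [hasFiniteIntegral_iff_ofReal (ae_of_all _ fun _ => sq_nonneg _)]
    exact lt_top_iff_ne_top.2 hfin
  have he : MemLp (fun x : ι → ℝ => g (Y x) - ∑ i, a i * x i) 2 (iidGaussian ι v) :=
    (memLp_two_iff_integrable_sq hm.aestronglyMeasurable).2 hI
  have ha := memLp_linearForm v a
  have hc := memLp_linearForm v c
  have hgL : MemLp (fun x : ι → ℝ => g (Y x)) 2 (iidGaussian ι v) := by
    convert he.add ha using 2
    simp
  have hind : IndepFun (fun x : ι → ℝ => g (Y x)) (fun x => ∑ i, c i * x i)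
      (iidGaussian ι v) :=
    ((indepFun_linearForm v c B h).comp (φ := fun y : Unit → ℝ => y ()) (ψ := g)
      (measurable_pi_apply ()) hg).symm
  have hg0 : ∫ x, g (Y x) * ∑ i, c i * x i ∂(iidGaussian ι v) = 0 := by
    have := hind.integral_fun_mul_eq_mul_integral hgL.aestronglyMeasurable hc.aestronglyMeasurable
    rw [this, integral_linearForm, mul_zero]
  rw [← ofReal_integral_eq_lintegral_ofReal hI (ae_of_all _ fun _ => sq_nonneg _)]
  refine ENNReal.ofReal_le_ofReal ?_
  have i1 : Integrable (fun x : ι → ℝ => 2 * (g (Y x) * ∑ i, c i * x i)) (iidGaussian ι v) :=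
    (hgL.integrable_mul hc).const_mul 2
  have i2 : Integrable (fun x : ι → ℝ => 2 * ((∑ i, a i * x i) * ∑ i, c i * x i))
      (iidGaussian ι v) := (ha.integrable_mul hc).const_mul 2
  have i3 : Integrable (fun x : ι → ℝ => 2 * (g (Y x) * ∑ i, c i * x i) -
      2 * ((∑ i, a i * x i) * ∑ i, c i * x i)) (iidGaussian ι v) := i1.sub i2
  -- With `e` the error and `s = ∑ i, c i * x i`, expanding `(e - s)² ≥ 0` gives `e² ≥ 2 e s - s²`.
  -- The unknown estimator drops out of the expectation because it is independent of the centred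
  -- `s`.
  have key : ∫ x, (2 * (g (Y x) * ∑ i, c i * x i) -
      2 * ((∑ i, a i * x i) * ∑ i, c i * x i) - (∑ i, c i * x i) ^ 2) ∂(iidGaussian ι v) =
      v * (-2 * ∑ i, a i * c i - ∑ i, c i ^ 2) := by
    rw [integral_sub i3 hc.integrable_sq, integral_sub i1 i2, integral_const_mul, integral_const_mul,
      hg0, integral_linearForm_mul, integral_linearForm_sq]
    ring
  rw [← key]
  refine integral_mono (i3.sub hc.integrable_sq) hI fun x => ?_
  dsimp only
  nlinarith [sq_nonneg (g (Y x) - ∑ i, a i * x i - ∑ i, c i * x i)]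

end GaussianVectors

/-! ### Posterior decomposition and the regret as a prediction error. -/

section Regret

variable {𝒳 : Type*} [MeasurableSpace 𝒳]

/-- Gaussian regression of the first summand on the sum: the residual is uncorrelated with the sum,
hence independent of it. Its law `γ` stays abstract since only its mean and square integrability are
used later; `A = 0` is included. -/
theorem exists_map_prod_gaussianReal_eq_prod (A B : ℝ≥0) (hB : 0 < B) :
    ∃ γ : Measure ℝ, IsProbabilityMeasure γ ∧ MemLp id 2 γ ∧ ∫ r, r ∂γ = 0 ∧
      ((gaussianReal 0 A).prod (gaussianReal 0 B)).map
        (fun p : ℝ × ℝ => (p.1 + p.2, p.1 - A / (A + B) * (p.1 + p.2))) =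
      (gaussianReal 0 (A + B)).prod γ := by
  set P := (gaussianReal 0 A).prod (gaussianReal 0 B)
  set ρ : ℝ := A / (A + B)
  have hAB : (A + B : ℝ) ≠ 0 := by positivity
  have m1 : MemLp (fun p : ℝ × ℝ => p.1) 2 P :=
    (memLp_id_gaussianReal 2).comp_measurePreserving measurePreserving_fst
  have m2 : MemLp (fun p : ℝ × ℝ => p.2) 2 P :=
    (memLp_id_gaussianReal 2).comp_measurePreserving measurePreserving_snd
  have e1 : ∫ p, p.1 ∂P = 0 := by
    have := (measurePreserving_fst (μ := gaussianReal 0 A) (ν := gaussianReal 0 B)).map_eq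
    rw [← integral_map (f := fun x : ℝ => x) (by fun_prop) (by fun_prop), this]
    simp
  have e2 : ∫ p, p.2 ∂P = 0 := by
    have := (measurePreserving_snd (μ := gaussianReal 0 A) (ν := gaussianReal 0 B)).map_eq
    rw [← integral_map (f := fun x : ℝ => x) (by fun_prop) (by fun_prop), this]
    simp
  have hind : IndepFun (fun p : ℝ × ℝ => p.1) (fun p => p.2) P :=
    indepFun_prod (X := id) (Y := id) measurable_id measurable_id
  have v1 : Var[fun p : ℝ × ℝ => p.1; P] = A := by
    have := variance_map (μ := P) (X := id) (Y := fun p : ℝ × ℝ => p.1) (by fun_prop) (by fun_prop)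
    rw [Function.id_comp, (measurePreserving_fst (μ := gaussianReal 0 A)
      (ν := gaussianReal 0 B)).map_eq, variance_id_gaussianReal] at this
    exact this.symm
  have v2 : Var[fun p : ℝ × ℝ => p.2; P] = B := by
    have := variance_map (μ := P) (X := id) (Y := fun p : ℝ × ℝ => p.2) (by fun_prop) (by fun_prop)
    rw [Function.id_comp, (measurePreserving_snd (μ := gaussianReal 0 A)
      (ν := gaussianReal 0 B)).map_eq, variance_id_gaussianReal] at this
    exact this.symm
  have hsum : MemLp (fun p : ℝ × ℝ => p.1 + p.2) 2 P := m1.add m2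
  have hres : MemLp (fun p : ℝ × ℝ => p.1 - ρ * (p.1 + p.2)) 2 P := m1.sub (hsum.const_mul ρ)
  have hcov : cov[fun p : ℝ × ℝ => p.1 + p.2, fun p => p.1 - ρ * (p.1 + p.2); P] = 0 := by
    have vs : Var[fun p : ℝ × ℝ => p.1 + p.2; P] = A + B := by
      have := hind.variance_fun_add m1 m2
      rw [this, v1, v2]
    have hc : cov[fun p : ℝ × ℝ => p.1 + p.2, fun p => p.1; P] = A := by
      have := covariance_add_left m1 m2 m1
      rw [show (fun p : ℝ × ℝ => p.1 + p.2) = (fun p => p.1) + fun p => p.2 from rfl, this,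
        covariance_self m1.aemeasurable, v1, covariance_comm,
        hind.covariance_eq_zero m1 m2, add_zero]
    have := covariance_sub_right hsum m1 (hsum.const_mul ρ)
    rw [show (fun p : ℝ × ℝ => p.1 - ρ * (p.1 + p.2)) =
      (fun p => p.1) - fun p => ρ * (p.1 + p.2) from rfl, this, hc, covariance_const_mul_right, covariance_self hsum.aemeasurable, vs]
    simp only [ρ]
    field_simp
    ring
  have hG : HasGaussianLaw (fun p : ℝ × ℝ => (p.1 + p.2, p.1 - ρ * (p.1 + p.2))) P := by
    let L : ℝ × ℝ →L[ℝ] ℝ × ℝ :=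
      (ContinuousLinearMap.fst ℝ ℝ ℝ + ContinuousLinearMap.snd ℝ ℝ ℝ).prod
        (ContinuousLinearMap.fst ℝ ℝ ℝ -
          ρ • (ContinuousLinearMap.fst ℝ ℝ ℝ + ContinuousLinearMap.snd ℝ ℝ ℝ))
    have hid : HasGaussianLaw (fun p : ℝ × ℝ => p) P := ⟨by
      simp only [Measure.map_id']; infer_instance⟩
    have := hid.map_fun L
    have e : (fun p : ℝ × ℝ => L p) = fun p => (p.1 + p.2, p.1 - ρ * (p.1 + p.2)) := by
      ext p <;> simp [L, mul_add]
    rwa [e] at this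
  have hI := hG.indepFun_of_covariance_eq_zero hcov
  have hlaw : P.map (fun p : ℝ × ℝ => p.1 + p.2) = gaussianReal 0 (A + B) := by
    have := gaussianReal_conv_gaussianReal (m₁ := 0) (m₂ := 0) (v₁ := A) (v₂ := B)
    rw [add_zero] at this
    exact this
  refine ⟨P.map fun p => p.1 - ρ * (p.1 + p.2), ?_, ?_, ?_, ?_⟩
  · exact Measure.isProbabilityMeasure_map (by fun_prop)
  · exact (memLp_map_measure_iff (by fun_prop) (by fun_prop)).2 hres
  · rw [integral_map (f := fun x : ℝ => x) (by fun_prop) (by fun_prop),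
      integral_sub (m1.integrable (by norm_num)) ((hsum.const_mul ρ).integrable (by norm_num)),
      integral_const_mul, integral_add (m1.integrable (by norm_num))
        (m2.integrable (by norm_num)), e1, e2]
    simp
  · rw [(indepFun_iff_map_prod_eq_prod_map_map (by fun_prop) (by fun_prop)).1 hI, hlaw]

/-- The model in terms of the marginal noise `Z - m(X)` and the independent posterior error. -/
theorem exists_modelLaw_eq_map_posterior (A σ : ℝ≥0) (hσ : 0 < σ) :
    ∃ γ : Measure ℝ, IsProbabilityMeasure γ ∧ MemLp id 2 γ ∧ ∫ r, r ∂γ = 0 ∧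
      ∀ (PX : Measure 𝒳) [IsProbabilityMeasure PX] {m : 𝒳 → ℝ}, Measurable m →
        modelLaw PX m A σ = ((PX.prod (gaussianReal 0 (A + σ ^ 2))).prod γ).map
          fun q => (q.1.1, m q.1.1 + A / (A + σ ^ 2) * q.1.2 + q.2, m q.1.1 + q.1.2) := by
  obtain ⟨γ, hγ, h2, h0, hmap⟩ := exists_map_prod_gaussianReal_eq_prod A (σ ^ 2) (by positivity)
  refine ⟨γ, hγ, h2, h0, fun PX _ m hm => ?_⟩
  rw [modelLaw_eq_map PX hm]
  have e1 : PX.prod ((gaussianReal 0 (A + σ ^ 2)).prod γ) =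
      (PX.prod ((gaussianReal 0 A).prod (gaussianReal 0 (σ ^ 2)))).map
        (Prod.map id fun p : ℝ × ℝ => (p.1 + p.2, p.1 - A / (A + ((σ ^ 2 : ℝ≥0) : ℝ)) * (p.1 + p.2))) := by
    rw [← Measure.map_prod_map _ _ measurable_id (by fun_prop), Measure.map_id, hmap]
  rw [← Measure.prodAssoc_prod] at e1
  have e2 := congrArg (Measure.map (MeasurableEquiv.prodAssoc (α := 𝒳) (β := ℝ) (γ := ℝ)).symm) e1
  rw [MeasurableEquiv.map_symm_map, Measure.map_map (by fun_prop) (by fun_prop)] at e2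
  rw [e2, Measure.map_map (by fun_prop) (by fun_prop)]
  congr 1
  ext q
  · rfl
  · change m q.1 + q.2.1 = m q.1 + A / (A + σ ^ 2) * (q.2.1 + q.2.2) +
      (q.2.1 - A / (A + ((σ ^ 2 : ℝ≥0) : ℝ)) * (q.2.1 + q.2.2))
    push_cast
    ring
  · change m q.1 + q.2.1 + q.2.2 = m q.1 + (q.2.1 + q.2.2)
    ring

theorem lintegral_sub_sq_eq_add {γ : Measure ℝ} [IsProbabilityMeasure γ] (h2 : MemLp id 2 γ)
    (h0 : ∫ r, r ∂γ = 0) (a : ℝ) :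
    ∫⁻ r, ENNReal.ofReal ((a - r) ^ 2) ∂γ =
      ENNReal.ofReal (a ^ 2) + ∫⁻ r, ENNReal.ofReal (r ^ 2) ∂γ := by
  have hs : Integrable (fun r : ℝ => r ^ 2) γ := h2.integrable_sq
  have h1 : Integrable (fun r : ℝ => r) γ := h2.integrable (by norm_num)
  have hi : Integrable (fun r : ℝ => a ^ 2 - 2 * a * r) γ :=
    (integrable_const _).sub (h1.const_mul _)
  have he : (fun r : ℝ => (a - r) ^ 2) = fun r => a ^ 2 - 2 * a * r + r ^ 2 := by ext r; ring
  rw [← ofReal_integral_eq_lintegral_ofReal hs (ae_of_all _ fun _ => sq_nonneg _),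
    ← ofReal_integral_eq_lintegral_ofReal (by rw [he]; exact hi.add hs)
      (ae_of_all _ fun _ => sq_nonneg _), ← ENNReal.ofReal_add (sq_nonneg _)
      (integral_nonneg fun _ => sq_nonneg _), he, integral_add hi hs,
    integral_sub (integrable_const _) (h1.const_mul _), integral_const_mul, h0]
  simp

/-- `μ` splits into a function `g` of the observation and a centred residual `r` independent of it;
conditioning keeps `g` and averages `r` to zero. -/
theorem bayesRule_ae_eq (PX : Measure 𝒳) [IsProbabilityMeasure PX] {m : 𝒳 → ℝ}
    (hm : Measurable m) (hmi : Integrable m PX) (A σ : ℝ≥0) (hσ : 0 < σ) :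
    bayesRule PX m A σ =ᵐ[modelLaw PX m A σ]
      fun p => m p.1 + A / (A + σ ^ 2) * (p.2.2 - m p.1) := by
  obtain ⟨γ, hγ, h2, h0, hmap⟩ := exists_modelLaw_eq_map_posterior (𝒳 := 𝒳) A σ hσ
  have hM := hmap PX hm
  set ρ : ℝ := A / (A + σ ^ 2)
  set Q := (PX.prod (gaussianReal 0 (A + σ ^ 2))).prod γ
  set F : (𝒳 × ℝ) × ℝ → 𝒳 × ℝ × ℝ :=
    fun q => (q.1.1, m q.1.1 + ρ * q.1.2 + q.2, m q.1.1 + q.1.2)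
  have hF : Measurable F := by fun_prop
  have hobs : Measurable (obs : 𝒳 × ℝ × ℝ → 𝒳 × ℝ) := by unfold obs; fun_prop
  have hMP : IsProbabilityMeasure (modelLaw PX m A σ) := by
    rw [hM]; exact Measure.isProbabilityMeasure_map hF.aemeasurable
  set g : 𝒳 × ℝ × ℝ → ℝ := fun p => m p.1 + ρ * (p.2.2 - m p.1)
  set r : 𝒳 × ℝ × ℝ → ℝ := fun p => p.2.1 - g p
  have hgm : Measurable g := by fun_prop
  have hrm : Measurable r := by fun_prop
  have hgF : g ∘ F = fun q => m q.1.1 + ρ * q.1.2 := by ext q; simp [g, F]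
  have hrF : r ∘ F = fun q => q.2 := by ext q; simp [r, g, F]
  have hoF : obs ∘ F = fun q => (q.1.1, m q.1.1 + q.1.2) := by ext q <;> simp [obs, F]
  have hri : Integrable r (modelLaw PX m A σ) := by
    rw [hM, integrable_map_measure hrm.aestronglyMeasurable hF.aemeasurable, hrF]
    exact (h2.integrable (by norm_num)).comp_snd _
  have hgi : Integrable g (modelLaw PX m A σ) := by
    rw [hM, integrable_map_measure hgm.aestronglyMeasurable hF.aemeasurable, hgF]
    have i1 : Integrable (fun q : 𝒳 × ℝ => m q.1 + ρ * q.2)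
        (PX.prod (gaussianReal 0 (A + σ ^ 2))) :=
      (hmi.comp_fst _).add ((((memLp_id_gaussianReal 1).integrable le_rfl).comp_snd _).const_mul ρ)
    exact i1.comp_fst _
  have hind : IndepFun r obs (modelLaw PX m A σ) := by
    rw [indepFun_iff_map_prod_eq_prod_map_map hrm.aemeasurable hobs.aemeasurable, hM,
      Measure.map_map hrm hF, Measure.map_map hobs hF, Measure.map_map (hrm.prodMk hobs) hF,
      hrF, hoF, show (fun a => (r a, obs a)) ∘ F =
        fun q => ((r ∘ F) q, (obs ∘ F) q) from rfl, hrF, hoF, ← indepFun_iff_map_prod_eq_prod_map_map (by fun_prop) (by fun_prop)]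
    exact (indepFun_prod (X := fun p : 𝒳 × ℝ => (p.1, m p.1 + p.2)) (Y := id)
      (by fun_prop) measurable_id).symm
  have hr0 : ∫ p, r p ∂(modelLaw PX m A σ) = 0 := by
    rw [hM, integral_map hF.aemeasurable hrm.aestronglyMeasurable]
    have : ∀ q, r (F q) = q.2 := fun q => congrFun hrF q
    simp_rw [this]
    have := (measurePreserving_snd (μ := PX.prod (gaussianReal 0 (A + σ ^ 2))) (ν := γ)).map_eq
    rw [← integral_map (f := fun x : ℝ => x) (by fun_prop) (by fun_prop), this, h0]
  have hle : MeasurableSpace.comap (obs : 𝒳 × ℝ × ℝ → 𝒳 × ℝ) inferInstance ≤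
      (inferInstance : MeasurableSpace (𝒳 × ℝ × ℝ)) := hobs.comap_le
  have hdec : (fun p : 𝒳 × ℝ × ℝ => p.2.1) = g + r := by ext p; simp [r]
  have hgs : StronglyMeasurable[MeasurableSpace.comap (obs : 𝒳 × ℝ × ℝ → 𝒳 × ℝ) inferInstance]
      g := by
    have : g = (fun o : 𝒳 × ℝ => m o.1 + ρ * (o.2 - m o.1)) ∘ obs := rfl
    rw [this]
    exact ((show Measurable fun o : 𝒳 × ℝ => m o.1 + ρ * (o.2 - m o.1) by fun_prop).comp
      (comap_measurable obs)).stronglyMeasurable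
  unfold bayesRule
  rw [hdec]
  refine (condExp_add hgi hri _).trans ?_
  rw [condExp_of_stronglyMeasurable hle hgs hgi]
  have h3 := condExp_indep_eq hrm.comap_le hle (comap_measurable r).stronglyMeasurable
    ((IndepFun_iff_Indep _ _ _).1 hind)
  filter_upwards [h3] with p hp
  rw [Pi.add_apply, hp, hr0, add_zero]

/-- Both risks contain the second moment of `γ`. Its finiteness makes the cancellation legitimate in
`ℝ≥0∞`. -/
theorem regret_eq_lintegral (PX : Measure 𝒳) [IsProbabilityMeasure PX] {m : 𝒳 → ℝ}
    (hm : Measurable m) (hmi : Integrable m PX) (A σ : ℝ≥0) (hσ : 0 < σ) {t : 𝒳 × ℝ → ℝ}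
    (ht : Measurable t) :
    regret PX m A σ t = ∫⁻ q, ENNReal.ofReal
      ((t (q.1, m q.1 + q.2) - (m q.1 + A / (A + σ ^ 2) * q.2)) ^ 2)
        ∂(PX.prod (gaussianReal 0 (A + σ ^ 2))) := by
  have hb := bayesRule_ae_eq PX hm hmi A σ hσ
  obtain ⟨γ, hγ, h2, h0, hmap⟩ := exists_modelLaw_eq_map_posterior (𝒳 := 𝒳) A σ hσ
  have hM := hmap PX hm
  set ρ : ℝ := A / (A + σ ^ 2)
  have hV : ∫⁻ r, ENNReal.ofReal (r ^ 2) ∂γ ≠ ⊤ := by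
    rw [← ofReal_integral_eq_lintegral_ofReal (f := fun r => r ^ 2) h2.integrable_sq
      (ae_of_all _ fun _ => sq_nonneg _)]
    exact ENNReal.ofReal_ne_top
  have key : ∀ {f : 𝒳 × ℝ → ℝ}, Measurable f →
      ∫⁻ p, ENNReal.ofReal ((f (obs p) - p.2.1) ^ 2) ∂(modelLaw PX m A σ) =
      ∫⁻ q, ENNReal.ofReal ((f (q.1, m q.1 + q.2) - (m q.1 + ρ * q.2)) ^ 2)
        ∂(PX.prod (gaussianReal 0 (A + σ ^ 2))) + ∫⁻ r, ENNReal.ofReal (r ^ 2) ∂γ := by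
    intro f hf
    have hobs : Measurable (obs : 𝒳 × ℝ × ℝ → 𝒳 × ℝ) := by unfold obs; fun_prop
    rw [hM, lintegral_map (by fun_prop) (by fun_prop), lintegral_prod _ (by
      unfold obs; fun_prop)]
    have : ∀ q : 𝒳 × ℝ, ∫⁻ r, ENNReal.ofReal ((f (obs (q.1, m q.1 + ρ * q.2 + r, m q.1 + q.2)) -
        (m q.1 + ρ * q.2 + r)) ^ 2) ∂γ = ENNReal.ofReal ((f (q.1, m q.1 + q.2) -
          (m q.1 + ρ * q.2)) ^ 2) + ∫⁻ r, ENNReal.ofReal (r ^ 2) ∂γ := by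
      intro q
      rw [← lintegral_sub_sq_eq_add h2 h0]
      refine lintegral_congr fun r => ?_
      rw [obs, ← sub_sub]
    simp_rw [this]
    rw [lintegral_add_right _ measurable_const]
    simp
  have hor : ∫⁻ p, ENNReal.ofReal ((bayesRule PX m A σ p - p.2.1) ^ 2) ∂(modelLaw PX m A σ) =
      ∫⁻ r, ENNReal.ofReal (r ^ 2) ∂γ := by
    -- The oracle is itself a function of the observation, and its excess term in `key` vanishes.
    have h4 := key (f := fun o => m o.1 + ρ * (o.2 - m o.1)) (by fun_prop)
    simp only [add_sub_cancel_left, sub_self, ne_eq, OfNat.ofNat_ne_zero, not_false_eq_true,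
      zero_pow, ENNReal.ofReal_zero, lintegral_zero, zero_add] at h4
    rw [← h4]
    refine lintegral_congr_ae ?_
    filter_upwards [hb] with p hp
    rw [hp]
    rfl
  rw [regret, hor, key ht]
  exact ENNReal.add_sub_cancel_right hV

theorem obsLaw_eq_map (PX : Measure 𝒳) [IsProbabilityMeasure PX] {m : 𝒳 → ℝ}
    (hm : Measurable m) (A σ : ℝ≥0) (hσ : 0 < σ) :
    obsLaw PX m A σ = (PX.prod (gaussianReal 0 (A + σ ^ 2))).map
      fun q => (q.1, m q.1 + q.2) := by
  obtain ⟨γ, hγ, h2, h0, hmap⟩ := exists_modelLaw_eq_map_posterior (𝒳 := 𝒳) A σ hσ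
  have hobs : Measurable (obs : 𝒳 × ℝ × ℝ → 𝒳 × ℝ) := by unfold obs; fun_prop
  rw [obsLaw, hmap PX hm, Measure.map_map hobs (by fun_prop)]
  have hz : Measurable fun q : 𝒳 × ℝ => (q.1, m q.1 + q.2) := by fun_prop
  have h := (measurePreserving_fst (μ := PX.prod (gaussianReal 0 (A + σ ^ 2))) (ν := γ)).map_eq
  conv_rhs => rw [← h, Measure.map_map hz measurable_fst]
  rfl

/-- The expected regret as an integral over the covariates and marginal noises of the future
point (index `0`) and of the data. -/
theorem expectedRegret_eq_lintegral (PX : Measure 𝒳) [IsProbabilityMeasure PX] {m : 𝒳 → ℝ}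
    (hm : Measurable m) (hmi : Integrable m PX) (A σ : ℝ≥0) (hσ : 0 < σ) (n : ℕ)
    {t : (Fin n → 𝒳 × ℝ) → 𝒳 × ℝ → ℝ} (ht : Measurable (Function.uncurry t)) :
    expectedRegret PX m A σ n t = ∫⁻ q : Fin (n + 1) → 𝒳 × ℝ, ENNReal.ofReal
      ((t (fun i => ((q i.succ).1, m (q i.succ).1 + (q i.succ).2)) ((q 0).1, m (q 0).1 + (q 0).2) -
        (m (q 0).1 + A / (A + σ ^ 2) * (q 0).2)) ^ 2)
        ∂(Measure.pi fun _ => PX.prod (gaussianReal 0 (A + σ ^ 2))) := by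
  set N := PX.prod (gaussianReal 0 (A + σ ^ 2))
  have hD : dataLaw PX m A σ n = (Measure.pi fun _ : Fin n => N).map
      fun q i => ((q i).1, m (q i).1 + (q i).2) := by
    have hp : IsProbabilityMeasure (N.map fun q => (q.1, m q.1 + q.2)) :=
      Measure.isProbabilityMeasure_map (by fun_prop)
    unfold dataLaw
    simp_rw [obsLaw_eq_map PX hm A σ hσ]
    exact (Measure.pi_map_pi (f := fun _ (q : 𝒳 × ℝ) => (q.1, m q.1 + q.2))
      fun _ => by fun_prop).symm
  have hmeas : Measurable fun p : (Fin n → 𝒳 × ℝ) × 𝒳 × ℝ => ENNReal.ofReal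
      ((t p.1 (p.2.1, m p.2.1 + p.2.2) - (m p.2.1 + A / (A + σ ^ 2) * p.2.2)) ^ 2) := by
    have : Measurable fun p : (Fin n → 𝒳 × ℝ) × 𝒳 × ℝ => t p.1 (p.2.1, m p.2.1 + p.2.2) :=
      ht.comp (f := fun p : (Fin n → 𝒳 × ℝ) × 𝒳 × ℝ => (p.1, (p.2.1, m p.2.1 + p.2.2)))
        (by fun_prop)
    fun_prop
  have hmeas2 : Measurable fun p : (𝒳 × ℝ) × (Fin n → 𝒳 × ℝ) => ENNReal.ofReal
      ((t (fun i => ((p.2 i).1, m (p.2 i).1 + (p.2 i).2)) (p.1.1, m p.1.1 + p.1.2) -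
        (m p.1.1 + A / (A + σ ^ 2) * p.1.2)) ^ 2) := by
    have : Measurable fun p : (𝒳 × ℝ) × (Fin n → 𝒳 × ℝ) =>
        t (fun i => ((p.2 i).1, m (p.2 i).1 + (p.2 i).2)) (p.1.1, m p.1.1 + p.1.2) :=
      ht.comp (f := fun p : (𝒳 × ℝ) × (Fin n → 𝒳 × ℝ) =>
        (fun i => ((p.2 i).1, m (p.2 i).1 + (p.2 i).2), (p.1.1, m p.1.1 + p.1.2))) (by fun_prop)
    fun_prop
  unfold expectedRegret
  have hr : ∀ D, regret PX m A σ (t D) = _ := fun D =>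
    regret_eq_lintegral PX hm hmi A σ hσ (ht.comp (measurable_const.prodMk measurable_id))
  simp_rw [hr]
  have hz : Measurable fun (q : Fin n → 𝒳 × ℝ) (i : Fin n) => ((q i).1, m (q i).1 + (q i).2) := by
    fun_prop
  rw [hD, lintegral_map hmeas.lintegral_prod_right' hz]
  -- Coordinate `0` is split off as the future point, independent of the `n` data points.
  have hmp := (measurePreserving_piFinSuccAbove (fun _ : Fin (n + 1) => N) 0)
  have := hmp.lintegral_comp hmeas2
  rw [lintegral_prod_symm' _ hmeas2] at this
  exact this.symm

end Regret

/-! ### Least squares through the future point, and the upper bound. -/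

section LeastSquares

open InnerProductSpace in
-- Needed for joint measurability of the denoiser: the projection is onto a subspace that moves with
-- the data.
theorem measurable_gramSchmidt {Ω E : Type*} [MeasurableSpace Ω] [NormedAddCommGroup E]
    [InnerProductSpace ℝ E] [MeasurableSpace E] [BorelSpace E] [SecondCountableTopology E] {d : ℕ}
    {V : Ω → Fin d → E} (hV : ∀ k, Measurable fun ω => V ω k) (k : Fin d) :
    Measurable fun ω => gramSchmidt ℝ (V ω) k := by
  induction k using WellFoundedLT.induction with
  | _ k ih =>
    have e : (fun ω => gramSchmidt ℝ (V ω) k) = fun ω => V ω k - ∑ i ∈ Finset.Iio k,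
        (inner ℝ (gramSchmidt ℝ (V ω) i) (V ω k) / ‖gramSchmidt ℝ (V ω) i‖ ^ 2) •
          gramSchmidt ℝ (V ω) i := by
      ext1 ω
      rw [gramSchmidt_def]
      simp_rw [Submodule.starProjection_singleton]
      rfl
    rw [e]
    refine (hV k).sub (Finset.measurable_fun_sum _ fun i hi => ?_)
    have h1 := ih i (Finset.mem_Iio.1 hi)
    have h2 := hV k
    fun_prop

open InnerProductSpace in
-- Gram–Schmidt vectors are orthogonal with the same span. Dependent vectors are allowed: a zero
-- Gram–Schmidt vector contributes a zero projection, so no rank condition on the design arises.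
theorem starProjection_span_range_eq_sum {E : Type*} [NormedAddCommGroup E]
    [InnerProductSpace ℝ E] [FiniteDimensional ℝ E] {d : ℕ} (v : Fin d → E) (x : E) :
    (Submodule.span ℝ (Set.range v)).starProjection x =
      ∑ k, (ℝ ∙ gramSchmidt ℝ v k).starProjection x := by
  have hmem : ∀ k, (ℝ ∙ gramSchmidt ℝ v k).starProjection x ∈ (ℝ ∙ gramSchmidt ℝ v k) :=
    fun k => Submodule.coe_mem _
  refine Submodule.eq_starProjection_of_mem_of_inner_eq_zero ?_ fun w hw => ?_
  · rw [← span_gramSchmidt ℝ v]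
    refine Submodule.sum_mem _ fun k _ => ?_
    exact Submodule.span_mono (Set.singleton_subset_iff.2 (Set.mem_range_self k)) (hmem k)
  · rw [← span_gramSchmidt ℝ v] at hw
    induction hw using Submodule.span_induction with
    | mem w hw =>
      obtain ⟨k, rfl⟩ := hw
      rw [inner_sub_left, sum_inner, Finset.sum_eq_single k]
      · rw [← inner_sub_left]
        exact Submodule.starProjection_inner_eq_zero _ _ (Submodule.mem_span_singleton_self _)
      · intro j _ hj
        obtain ⟨c, hc⟩ := Submodule.mem_span_singleton.1 (hmem j)
        rw [← hc, inner_smul_left, gramSchmidt_orthogonal ℝ v hj, mul_zero]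
      · simp
    | zero => simp
    | add a b _ _ ha hb => rw [inner_add_right, ha, hb, add_zero]
    | smul c a _ ha => rw [inner_smul_right, ha, mul_zero]

variable {d N : ℕ}

/-- The span of the columns of the design matrix with rows `X i`. -/
def columnSpan (X : Fin N → EuclideanSpace ℝ (Fin d)) :
    Submodule ℝ (EuclideanSpace ℝ (Fin N)) :=
  Submodule.span ℝ (Set.range fun k => WithLp.toLp 2 fun i => X i k)

/-- The least squares fit of the responses `z` at the design points `X`. -/
noncomputable def leastSquaresFit (X : Fin N → EuclideanSpace ℝ (Fin d)) (z : Fin N → ℝ) :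
    EuclideanSpace ℝ (Fin N) :=
  (columnSpan X).starProjection (WithLp.toLp 2 z)

theorem finrank_columnSpan_le (X : Fin N → EuclideanSpace ℝ (Fin d)) :
    Module.finrank ℝ (columnSpan X) ≤ d :=
  (finrank_range_le_card (R := ℝ)
    (fun k : Fin d => (WithLp.toLp 2 fun i => X i k : EuclideanSpace ℝ (Fin N)))).trans_eq
    (Fintype.card_fin d)

theorem measurable_leastSquaresFit :
    Measurable fun p : (Fin N → EuclideanSpace ℝ (Fin d)) × (Fin N → ℝ) =>
      leastSquaresFit p.1 p.2 := by
  simp_rw [leastSquaresFit, columnSpan, starProjection_span_range_eq_sum,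
    Submodule.starProjection_singleton]
  refine Finset.measurable_fun_sum _ fun k _ => ?_
  have h := measurable_gramSchmidt
    (V := fun (p : (Fin N → EuclideanSpace ℝ (Fin d)) × (Fin N → ℝ)) k =>
      (WithLp.toLp 2 fun i => p.1 i k : EuclideanSpace ℝ (Fin N))) (fun k => by fun_prop) k
  have hz : Measurable fun p : (Fin N → EuclideanSpace ℝ (Fin d)) × (Fin N → ℝ) =>
      (WithLp.toLp 2 p.2 : EuclideanSpace ℝ (Fin N)) := by fun_prop
  simp only [RCLike.ofReal_real_eq_id, id_eq]
  fun_prop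

/-- The signal lies in the column span, so the projection fixes it and acts only on the noise. -/
theorem leastSquaresFit_inner_add (X : Fin N → EuclideanSpace ℝ (Fin d))
    (β : EuclideanSpace ℝ (Fin d)) (ε : Fin N → ℝ) (i : Fin N) :
    leastSquaresFit X (fun i => inner ℝ (X i) β + ε i) i =
      inner ℝ (X i) β + leastSquaresFit X ε i := by
  have h1 : (WithLp.toLp 2 fun i => inner ℝ (X i) β + ε i : EuclideanSpace ℝ (Fin N)) =
      WithLp.toLp 2 (fun i => inner ℝ (X i) β) + WithLp.toLp 2 ε := rfl
  have h2 : (WithLp.toLp 2 (fun i => inner ℝ (X i) β) : EuclideanSpace ℝ (Fin N)) ∈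
      columnSpan X := by
    have : (WithLp.toLp 2 (fun i => inner ℝ (X i) β) : EuclideanSpace ℝ (Fin N)) =
        ∑ k, β k • (WithLp.toLp 2 fun i => X i k : EuclideanSpace ℝ (Fin N)) := by
      ext i
      simp [PiLp.inner_apply]
    rw [this]
    exact Submodule.sum_mem _ fun k _ => Submodule.smul_mem _ _
      (Submodule.subset_span (Set.mem_range_self k))
  rw [leastSquaresFit, h1, map_add, Submodule.starProjection_eq_self_iff.2 h2]
  rfl

/-- Permuting the sample is an isometry that carries one column span to the other. -/
theorem leastSquaresFit_comp_equiv (e : Fin N ≃ Fin N) (X : Fin N → EuclideanSpace ℝ (Fin d))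
    (z : Fin N → ℝ) (i : Fin N) :
    leastSquaresFit (X ∘ e) (z ∘ e) i = leastSquaresFit X z (e i) := by
  let f := LinearIsometryEquiv.piLpCongrLeft 2 ℝ ℝ e.symm
  have hf : ∀ w : Fin N → ℝ, f (WithLp.toLp 2 w) = WithLp.toLp 2 (w ∘ e) := by
    intro w
    ext j
    simp [f, LinearIsometryEquiv.piLpCongrLeft_apply, Equiv.piCongrLeft']
  have hs : columnSpan (X ∘ e) = (columnSpan X).map (f.toLinearEquiv : _ →ₗ[ℝ] _) := by
    rw [columnSpan, columnSpan, Submodule.map_span, ← Set.range_comp]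
    congr 2
  have hp : ∀ U W : Submodule ℝ (EuclideanSpace ℝ (Fin N)), U = W →
      U.starProjection = W.starProjection := by
    rintro U _ rfl
    rfl
  rw [leastSquaresFit, hp _ _ hs, Submodule.starProjection_map_apply, ← hf, f.symm_apply_apply]
  simp [f, LinearIsometryEquiv.piLpCongrLeft_apply, Equiv.piCongrLeft', leastSquaresFit]

/-- In an orthonormal basis of the column span each noise coordinate has variance `v`, and there are
at most `d` of them. -/
theorem lintegral_norm_leastSquaresFit_sq_le (X : Fin N → EuclideanSpace ℝ (Fin d)) (v : ℝ≥0) :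
    ∫⁻ ε, ENNReal.ofReal (‖leastSquaresFit X ε‖ ^ 2) ∂(iidGaussian (Fin N) v) ≤
      ENNReal.ofReal (v * d) := by
  let b := stdOrthonormalBasis ℝ (columnSpan X)
  have h : ∀ ε : Fin N → ℝ, ENNReal.ofReal (‖leastSquaresFit X ε‖ ^ 2) =
      ∑ j, ENNReal.ofReal ((∑ i, (b j : EuclideanSpace ℝ (Fin N)) i * ε i) ^ 2) := by
    intro ε
    rw [← ENNReal.ofReal_sum_of_nonneg fun _ _ => sq_nonneg _]
    congr 1
    have h1 : ‖leastSquaresFit X ε‖ =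
        ‖(columnSpan X).orthogonalProjectionOnto (WithLp.toLp 2 ε)‖ := rfl
    rw [h1, ← b.sum_sq_norm_inner_right]
    refine Finset.sum_congr rfl fun j _ => ?_
    rw [Submodule.inner_orthogonalProjectionOnto_eq_of_mem_left]
    simp [PiLp.inner_apply, mul_comm]
  simp_rw [h]
  rw [lintegral_finsetSum _ fun j _ => by fun_prop]
  simp_rw [lintegral_linearForm_sq]
  have hb : ∀ j, ∑ i, (b j : EuclideanSpace ℝ (Fin N)) i ^ 2 = 1 := by
    intro j
    rw [← EuclideanSpace.real_norm_sq_eq, Submodule.norm_coe, b.norm_eq_one, one_pow]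
  simp_rw [hb]
  rw [← ENNReal.ofReal_sum_of_nonneg fun _ _ => by positivity]
  refine ENNReal.ofReal_le_ofReal ?_
  have := finrank_columnSpan_le X
  simp only [mul_one, Finset.sum_const, Finset.card_univ, Fintype.card_fin, nsmul_eq_mul]
  rw [mul_comm]
  gcongr

/-- The `n + 1` pairs are exchangeable, so every fitted coordinate has the same second moment, an
equal share of the total `E ‖Pε‖² ≤ v d`. -/
theorem lintegral_leastSquaresFit_zero_sq_le (PX : Measure (EuclideanSpace ℝ (Fin d)))
    [IsProbabilityMeasure PX] (v : ℝ≥0) (n : ℕ) :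
    ∫⁻ q : Fin (n + 1) → EuclideanSpace ℝ (Fin d) × ℝ,
      ENNReal.ofReal ((leastSquaresFit (fun i => (q i).1) (fun i => (q i).2) 0) ^ 2)
        ∂(Measure.pi fun _ => PX.prod (gaussianReal 0 v)) ≤
      ENNReal.ofReal (v * d / (n + 1)) := by
  set Q := Measure.pi fun _ : Fin (n + 1) => PX.prod (gaussianReal 0 v)
  have hfit : Measurable fun q : Fin (n + 1) → EuclideanSpace ℝ (Fin d) × ℝ =>
      leastSquaresFit (fun i => (q i).1) (fun i => (q i).2) :=
    measurable_leastSquaresFit.comp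
      (f := fun q : Fin (n + 1) → EuclideanSpace ℝ (Fin d) × ℝ =>
        ((fun i => (q i).1), fun i => (q i).2)) (by fun_prop)
  have hfiti : ∀ i, Measurable fun q : Fin (n + 1) → EuclideanSpace ℝ (Fin d) × ℝ =>
      ENNReal.ofReal (leastSquaresFit (fun i => (q i).1) (fun i => (q i).2) i ^ 2) := by
    intro i; fun_prop
  have hex : ∀ i, ∫⁻ q, ENNReal.ofReal
      ((leastSquaresFit (fun i => (q i).1) (fun i => (q i).2) i) ^ 2) ∂Q =
      ∫⁻ q, ENNReal.ofReal ((leastSquaresFit (fun i => (q i).1) (fun i => (q i).2) 0) ^ 2) ∂Q := by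
    intro i
    let e : Fin (n + 1) ≃ Fin (n + 1) := Equiv.swap 0 i
    have hmp := measurePreserving_piCongrLeft
      (fun _ : Fin (n + 1) => PX.prod (gaussianReal 0 v)) e.symm
    rw [← hmp.lintegral_comp (hfiti 0)]
    refine lintegral_congr fun q => ?_
    have hq : ∀ j, MeasurableEquiv.piCongrLeft
        (fun _ : Fin (n + 1) => EuclideanSpace ℝ (Fin d) × ℝ) e.symm q j = q (e j) := by
      intro j
      exact (Equiv.piCongrLeft_apply (P := fun _ : Fin (n + 1) => EuclideanSpace ℝ (Fin d) × ℝ)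
        e.symm q j).trans (by simp)
    simp_rw [hq]
    have := leastSquaresFit_comp_equiv e (fun i => (q i).1) (fun i => (q i).2) 0
    simp only [Function.comp_def] at this
    rw [this, Equiv.swap_apply_left]
  have htot : ∫⁻ q, ENNReal.ofReal
      (‖leastSquaresFit (fun i => (q i).1) (fun i => (q i).2)‖ ^ 2) ∂Q ≤
      ENNReal.ofReal (v * d) := by
    have hmp := measurePreserving_arrowProdEquivProdArrow (EuclideanSpace ℝ (Fin d)) ℝ
      (Fin (n + 1)) (fun _ => PX) (fun _ => gaussianReal 0 v)
    have hm : Measurable fun p : (Fin (n + 1) → EuclideanSpace ℝ (Fin d)) × (Fin (n + 1) → ℝ) =>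
        ENNReal.ofReal (‖leastSquaresFit p.1 p.2‖ ^ 2) := by
      have := measurable_leastSquaresFit (d := d) (N := n + 1)
      fun_prop
    have h := hmp.lintegral_comp hm
    rw [lintegral_prod _ hm.aemeasurable] at h
    calc _ = _ := h
      _ ≤ ∫⁻ _, ENNReal.ofReal (v * d)
          ∂(Measure.pi fun _ : Fin (n + 1) => PX) :=
        lintegral_mono fun X => lintegral_norm_leastSquaresFit_sq_le X v
      _ = ENNReal.ofReal (v * d) := by simp
  have hsum : ∀ q : Fin (n + 1) → EuclideanSpace ℝ (Fin d) × ℝ, ENNReal.ofReal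
      (‖leastSquaresFit (fun i => (q i).1) (fun i => (q i).2)‖ ^ 2) =
      ∑ i, ENNReal.ofReal ((leastSquaresFit (fun i => (q i).1) (fun i => (q i).2) i) ^ 2) := by
    intro q
    rw [EuclideanSpace.real_norm_sq_eq, ENNReal.ofReal_sum_of_nonneg fun _ _ => sq_nonneg _]
  simp_rw [hsum] at htot
  rw [lintegral_finsetSum _ fun i _ => hfiti i] at htot
  simp_rw [hex] at htot
  rw [Finset.sum_const, Finset.card_univ, Fintype.card_fin, nsmul_eq_mul] at htot
  rw [ENNReal.ofReal_div_of_pos (by positivity), ENNReal.le_div_iff_mul_le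
    (Or.inl (by positivity)) (Or.inl ENNReal.ofReal_ne_top), mul_comm]
  convert htot using 2
  rw [← Nat.cast_add_one, ENNReal.ofReal_natCast]

/-- The denoiser that plugs in the least squares fit based on the data and the future point. -/
noncomputable def leastSquaresDenoiser (d : ℕ) (A σ : ℝ≥0) (n : ℕ)
    (D : Fin n → EuclideanSpace ℝ (Fin d) × ℝ) (o : EuclideanSpace ℝ (Fin d) × ℝ) : ℝ :=
  A / (A + σ ^ 2) * o.2 + σ ^ 2 / (A + σ ^ 2) *
    leastSquaresFit (Fin.cons o.1 fun i => (D i).1) (Fin.cons o.2 fun i => (D i).2) 0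

theorem measurable_leastSquaresDenoiser (d : ℕ) (A σ : ℝ≥0) (n : ℕ) :
    Measurable (Function.uncurry (leastSquaresDenoiser d A σ n)) := by
  have h1 : Measurable fun p : (Fin n → EuclideanSpace ℝ (Fin d) × ℝ) ×
      EuclideanSpace ℝ (Fin d) × ℝ =>
      ((Fin.cons p.2.1 fun i => (p.1 i).1 : Fin (n + 1) → EuclideanSpace ℝ (Fin d)),
        (Fin.cons p.2.2 fun i => (p.1 i).2 : Fin (n + 1) → ℝ)) := by
    refine Measurable.prodMk (measurable_pi_iff.2 fun i => ?_) (measurable_pi_iff.2 fun i => ?_) <;>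
    · refine Fin.cases ?_ (fun j => ?_) i <;> simp only [Fin.cons_zero, Fin.cons_succ] <;> fun_prop
  have h2 := measurable_leastSquaresFit.comp h1
  have h3 : Measurable fun p : (Fin n → EuclideanSpace ℝ (Fin d) × ℝ) ×
      EuclideanSpace ℝ (Fin d) × ℝ =>
      leastSquaresFit (Fin.cons p.2.1 fun i => (p.1 i).1)
        (Fin.cons p.2.2 fun i => (p.1 i).2) 0 := by
    simp only [Function.comp_def] at h2
    fun_prop
  unfold leastSquaresDenoiser Function.uncurry
  fun_prop

theorem expectedRegret_leastSquaresDenoiser_le (PX : Measure (EuclideanSpace ℝ (Fin d)))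
    [IsProbabilityMeasure PX] (hPX : Integrable id PX) (β : EuclideanSpace ℝ (Fin d))
    (A σ : ℝ≥0) (hσ : 0 < σ) (n : ℕ) :
    expectedRegret PX (fun x => inner ℝ x β) A σ n (leastSquaresDenoiser d A σ n) ≤
      ENNReal.ofReal ((σ ^ 2 / (A + σ ^ 2)) ^ 2 * ((A + σ ^ 2) * d / (n + 1))) := by
  have hmi : Integrable (fun x => inner ℝ x β) PX := hPX.inner_const β
  rw [expectedRegret_eq_lintegral PX (by fun_prop) hmi A σ hσ n
    (measurable_leastSquaresDenoiser d A σ n)]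
  have hs : (A + σ ^ 2 : ℝ) ≠ 0 := by positivity
  have key : ∀ q : Fin (n + 1) → EuclideanSpace ℝ (Fin d) × ℝ,
      ENNReal.ofReal ((leastSquaresDenoiser d A σ n
        (fun i => ((q i.succ).1, inner ℝ (q i.succ).1 β + (q i.succ).2))
        ((q 0).1, inner ℝ (q 0).1 β + (q 0).2) -
        (inner ℝ (q 0).1 β + A / (A + σ ^ 2) * (q 0).2)) ^ 2) =
      ENNReal.ofReal ((σ ^ 2 / (A + σ ^ 2)) ^ 2) *
        ENNReal.ofReal ((leastSquaresFit (fun i => (q i).1) (fun i => (q i).2) 0) ^ 2) := by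
    intro q
    have e1 : (Fin.cons (q 0).1 fun i => (q i.succ).1 : Fin (n + 1) → EuclideanSpace ℝ (Fin d)) =
        fun i => (q i).1 := by
      ext1 i; refine Fin.cases ?_ (fun j => ?_) i <;> simp
    have e2 : (Fin.cons (inner ℝ (q 0).1 β + (q 0).2)
        fun i => inner ℝ (q i.succ).1 β + (q i.succ).2 : Fin (n + 1) → ℝ) =
        fun i => inner ℝ (q i).1 β + (q i).2 := by
      ext1 i; refine Fin.cases ?_ (fun j => ?_) i <;> simp
    rw [← ENNReal.ofReal_mul (sq_nonneg _), ← mul_pow, leastSquaresDenoiser]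
    simp only
    rw [e1, e2, leastSquaresFit_inner_add (fun i => (q i).1)]
    congr 2
    field_simp
    ring
  simp_rw [key]
  rw [lintegral_const_mul' _ _ ENNReal.ofReal_ne_top, ENNReal.ofReal_mul (sq_nonneg _)]
  gcongr
  have := lintegral_leastSquaresFit_zero_sq_le PX (A + σ ^ 2) n
  push_cast at this
  exact this

end LeastSquares

/-! ### Bayes lower bound for isotropic features. -/

section LowerBound

/-- Used to average a lower bound that may be negative for some covariates; `ENNReal.ofReal`
truncates it to its positive part. -/
theorem ofReal_integral_le_lintegral_ofReal {Ω : Type*} [MeasurableSpace Ω] {P : Measure Ω}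
    {f : Ω → ℝ} (hf : Integrable f P) :
    ENNReal.ofReal (∫ x, f x ∂P) ≤ ∫⁻ x, ENNReal.ofReal (f x) ∂P := by
  have h : ∀ x, ENNReal.ofReal (f x) = ENNReal.ofReal (max (f x) 0) := by
    intro x; simp [ENNReal.ofReal, Real.toNNReal]
  simp_rw [h]
  rw [← ofReal_integral_eq_lintegral_ofReal hf.pos_part (ae_of_all _ fun _ => le_max_right _ _)]
  exact ENNReal.ofReal_le_ofReal (integral_mono hf hf.pos_part fun _ => le_max_left _ _)

variable {𝒳 : Type*} [MeasurableSpace 𝒳] {d : ℕ}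

/-- The Bayes risk under a Gaussian prior on the coefficients, for fixed feature vectors `Φ i` of
the future point (index `0`) and of the data. -/
theorem bayesRisk_linearModel_ge (n : ℕ) (v : ℝ≥0) (ρ c : ℝ) (Φ : Fin (n + 1) → Fin d → ℝ)
    {g : (Fin (n + 1) → ℝ) → ℝ} (hg : Measurable g) :
    ENNReal.ofReal (v * (1 - ρ) ^ 2 * (2 * c * ∑ k, Φ 0 k ^ 2 -
        c ^ 2 * (∑ j, (∑ k, Φ 0 k * Φ j k) ^ 2 + ∑ k, Φ 0 k ^ 2))) ≤
      ∫⁻ ε, ∫⁻ b, ENNReal.ofReal ((g (fun j => ∑ k, Φ j k * b k + ε j) -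
        (∑ k, Φ 0 k * b k + ρ * ε 0)) ^ 2) ∂(iidGaussian (Fin d) v)
          ∂(iidGaussian (Fin (n + 1)) v) := by
  let B : Fin (n + 1) → Fin (n + 1) ⊕ Fin d → ℝ := fun j => Sum.elim (Pi.single j 1) (Φ j)
  let a : Fin (n + 1) ⊕ Fin d → ℝ := Sum.elim 0 fun k => (1 - ρ) * Φ 0 k
  -- The optimal `s` is minus the posterior error of the target `a`. Here the posterior covariance
  -- `v (I + ΦᵀΦ)⁻¹` is replaced by `v c I`, and the noise coefficients are then forced by
  -- orthogonality to every observation.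
  let s : Fin (n + 1) ⊕ Fin d → ℝ :=
    Sum.elim (fun j => (1 - ρ) * c * ∑ k, Φ 0 k * Φ j k) fun k => -((1 - ρ) * c * Φ 0 k)
  have hs : ∀ j, ∑ i, s i * B j i = 0 := by
    intro j
    simp only [s, B, Fintype.sum_sum_type, Sum.elim_inl, Sum.elim_inr, Pi.single_apply, mul_ite,
      mul_one, mul_zero, Finset.sum_ite_eq', Finset.mem_univ, if_true, neg_mul,
      Finset.sum_neg_distrib, Finset.mul_sum]
    rw [add_neg_eq_zero]
    exact Finset.sum_congr rfl fun k _ => by ring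
  -- Since `y 0` is observed, subtracting `ρ * y 0` removes the noise from the target and leaves `(1
  -- - ρ) ∑ k, Φ 0 k * b k`.
  have h := bayesRisk_linearForm_ge v a s B hs (g := fun y => g y - ρ * y 0) (by fun_prop)
  have hval : (v : ℝ) * (-2 * ∑ i, a i * s i - ∑ i, s i ^ 2) =
      v * (1 - ρ) ^ 2 * (2 * c * ∑ k, Φ 0 k ^ 2 -
        c ^ 2 * (∑ j, (∑ k, Φ 0 k * Φ j k) ^ 2 + ∑ k, Φ 0 k ^ 2)) := by
    have e1 : ∑ i, a i * s i = -((1 - ρ) ^ 2 * c * ∑ k, Φ 0 k ^ 2) := by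
      simp only [a, s, Fintype.sum_sum_type, Sum.elim_inl, Sum.elim_inr, Pi.zero_apply, zero_mul,
        Finset.sum_const_zero, zero_add, Finset.mul_sum, ← Finset.sum_neg_distrib]
      exact Finset.sum_congr rfl fun k _ => by ring
    have e2 : ∑ i, s i ^ 2 = (1 - ρ) ^ 2 * c ^ 2 *
        (∑ j, (∑ k, Φ 0 k * Φ j k) ^ 2 + ∑ k, Φ 0 k ^ 2) := by
      simp only [s, Fintype.sum_sum_type, Sum.elim_inl, Sum.elim_inr, mul_add]
      congr 1 <;> rw [Finset.mul_sum] <;> exact Finset.sum_congr rfl fun k _ => by ring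
    rw [e1, e2]
    ring
  rw [hval] at h
  refine h.trans_eq ?_
  have hmp := measurePreserving_sumPiEquivProdPi_symm (X := fun _ : Fin (n + 1) ⊕ Fin d => ℝ)
    (fun _ => gaussianReal 0 v)
  have hm : Measurable fun x : Fin (n + 1) ⊕ Fin d → ℝ => ENNReal.ofReal
      ((g (fun j => ∑ i, B j i * x i) - ρ * (∑ i, B 0 i * x i) - ∑ i, a i * x i) ^ 2) := by
    fun_prop
  refine (hmp.lintegral_comp hm).symm.trans
    ((lintegral_prod _ (hm.comp hmp.measurable).aemeasurable).trans ?_)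
  refine lintegral_congr fun ε => lintegral_congr fun b => ?_
  change ENNReal.ofReal ((g (fun j => ∑ i, B j i * Sum.elim ε b i) -
    ρ * (∑ i, B 0 i * Sum.elim ε b i) - ∑ i, a i * Sum.elim ε b i) ^ 2) = _
  have hB : ∀ j, ∑ i, B j i * Sum.elim ε b i = ∑ k, Φ j k * b k + ε j := by
    intro j
    simp only [B, Fintype.sum_sum_type, Sum.elim_inl, Sum.elim_inr, Pi.single_apply,
      ite_mul, one_mul, zero_mul, Finset.sum_ite_eq', Finset.mem_univ, if_true]
    ring
  have ha : ∑ i, a i * Sum.elim ε b i = (1 - ρ) * ∑ k, Φ 0 k * b k := by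
    simp only [a, Fintype.sum_sum_type, Sum.elim_inl, Sum.elim_inr, Pi.zero_apply,
      zero_mul, Finset.sum_const_zero, zero_add, Finset.mul_sum, mul_assoc]
  simp_rw [hB, ha]
  congr 2
  ring

/-- The mean over the covariates of the bound in `bayesRisk_linearModel_ge`, for isotropic
features with finite fourth moments. -/
theorem lintegral_bayesRisk_bound_ge (PX : Measure 𝒳) [IsProbabilityMeasure PX]
    {φ : 𝒳 → Fin d → ℝ} (hφ : Measurable φ) (h2 : ∀ k, MemLp (fun x => φ x k) 2 PX)
    (hiso : ∀ u : Fin d → ℝ, ∫ x, (∑ k, u k * φ x k) ^ 2 ∂PX = ∑ k, u k ^ 2)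
    (h4 : Integrable (fun x => (∑ k, φ x k ^ 2) ^ 2) PX) (n : ℕ) (w : ℝ) (c : ℝ) :
    ENNReal.ofReal (w * (2 * c * d - c ^ 2 * (n * d + d + ∫ x, (∑ k, φ x k ^ 2) ^ 2 ∂PX))) ≤
      ∫⁻ X : Fin (n + 1) → 𝒳, ENNReal.ofReal (w * (2 * c * ∑ k, φ (X 0) k ^ 2 -
        c ^ 2 * (∑ j, (∑ k, φ (X 0) k * φ (X j) k) ^ 2 + ∑ k, φ (X 0) k ^ 2)))
          ∂(Measure.pi fun _ => PX) := by
  have hφk : ∀ k, Measurable fun x => φ x k := fun k => (measurable_pi_apply k).comp hφ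
  have hS : Integrable (fun x => ∑ k, φ x k ^ 2) PX :=
    integrable_finsetSum _ fun k _ => (h2 k).integrable_sq
  have hd : ∫ x, ∑ k, φ x k ^ 2 ∂PX = d := by
    rw [integral_finsetSum _ fun k _ => (h2 k).integrable_sq]
    have : ∀ k, ∫ x, φ x k ^ 2 ∂PX = 1 := by
      intro k
      have := hiso (Pi.single k 1)
      simpa [Pi.single_apply, ite_pow] using this
    simp [this]
  have hmp := measurePreserving_piFinSuccAbove (fun _ : Fin (n + 1) => PX) 0
  have hm : Measurable fun p : 𝒳 × (Fin n → 𝒳) => ENNReal.ofReal (w * (2 * c * ∑ k, φ p.1 k ^ 2 -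
      c ^ 2 * ((∑ k, φ p.1 k * φ p.1 k) ^ 2 + ∑ j, (∑ k, φ p.1 k * φ (p.2 j) k) ^ 2 +
        ∑ k, φ p.1 k ^ 2))) := by
    fun_prop
  -- The term `j = 0`, the future point against itself, yields the fourth moment; by isotropy each
  -- of the other `n` terms averages to `∑ k, φ x k ^ 2`.
  simp_rw [Fin.sum_univ_succ (n := n)]
  refine le_of_le_of_eq ?_
    ((hmp.lintegral_comp hm).trans (lintegral_prod _ hm.aemeasurable)).symm
  have hin : ∀ x : 𝒳, ENNReal.ofReal (w * (2 * c * ∑ k, φ x k ^ 2 -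
      c ^ 2 * ((∑ k, φ x k ^ 2) ^ 2 + n * ∑ k, φ x k ^ 2 + ∑ k, φ x k ^ 2))) ≤
      ∫⁻ Y : Fin n → 𝒳, ENNReal.ofReal (w * (2 * c * ∑ k, φ x k ^ 2 -
        c ^ 2 * ((∑ k, φ x k * φ x k) ^ 2 + ∑ j, (∑ k, φ x k * φ (Y j) k) ^ 2 +
          ∑ k, φ x k ^ 2))) ∂(Measure.pi fun _ => PX) := by
    intro x
    have hL : MemLp (fun y => ∑ k, φ x k * φ y k) 2 PX :=
      memLp_finsetSum _ fun k _ => (h2 k).const_mul _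
    have hI : ∀ j : Fin n, Integrable (fun Y : Fin n → 𝒳 => (∑ k, φ x k * φ (Y j) k) ^ 2)
        (Measure.pi fun _ => PX) := fun j =>
      (measurePreserving_eval (fun _ : Fin n => PX) j).integrable_comp_of_integrable
        hL.integrable_sq
    have hIv : ∀ j : Fin n, ∫ Y : Fin n → 𝒳, (∑ k, φ x k * φ (Y j) k) ^ 2
        ∂(Measure.pi fun _ => PX) = ∑ k, φ x k ^ 2 := by
      intro j
      rw [← hiso (φ x)]
      have hev := (measurePreserving_eval (fun _ : Fin n => PX) j)
      conv_rhs => rw [← hev.map_eq]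
      rw [integral_map hev.measurable.aemeasurable
        (Measurable.aestronglyMeasurable (by fun_prop))]
    have hsum := integrable_finsetSum (μ := Measure.pi fun _ : Fin n => PX) Finset.univ
      fun j _ => hI j
    have h1 : Integrable (fun Y : Fin n → 𝒳 => (∑ k, φ x k * φ x k) ^ 2 +
        ∑ j, (∑ k, φ x k * φ (Y j) k) ^ 2) (Measure.pi fun _ => PX) :=
      (integrable_const _).add hsum
    have h3 : Integrable (fun Y : Fin n → 𝒳 => c ^ 2 * ((∑ k, φ x k * φ x k) ^ 2 +
        ∑ j, (∑ k, φ x k * φ (Y j) k) ^ 2 + ∑ k, φ x k ^ 2)) (Measure.pi fun _ => PX) :=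
      (h1.add (integrable_const _)).const_mul _
    refine le_of_eq_of_le ?_ (ofReal_integral_le_lintegral_ofReal
      (((integrable_const _).sub h3).const_mul w))
    congr 1
    rw [integral_const_mul, integral_sub (integrable_const _) h3, integral_const_mul,
      integral_const_mul, integral_add h1 (integrable_const _), integral_add (integrable_const _) hsum,
      integral_finsetSum _ fun j _ => hI j]
    simp_rw [hIv, ← pow_two]
    simp
  refine le_trans ?_ (lintegral_mono hin)
  have h3 : Integrable (fun x => (∑ k, φ x k ^ 2) ^ 2 + n * ∑ k, φ x k ^ 2) PX :=
    h4.add (hS.const_mul _)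
  have h5 : Integrable (fun x => c ^ 2 * ((∑ k, φ x k ^ 2) ^ 2 + n * ∑ k, φ x k ^ 2 +
      ∑ k, φ x k ^ 2)) PX := (h3.add hS).const_mul _
  refine le_of_eq_of_le ?_ (ofReal_integral_le_lintegral_ofReal
    (((hS.const_mul (2 * c)).sub h5).const_mul w))
  congr 1
  rw [integral_const_mul, integral_sub (hS.const_mul _) h5, integral_const_mul,
    integral_const_mul, integral_add h3 hS, integral_add h4 (hS.const_mul _), integral_const_mul,
    hd]
  ring

/-- A lower bound for the worst expected regret over the linear span of isotropic features. -/
theorem iSup_expectedRegret_ge (PX : Measure 𝒳) [IsProbabilityMeasure PX]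
    {φ : 𝒳 → Fin d → ℝ} (hφ : Measurable φ) (h2 : ∀ k, MemLp (fun x => φ x k) 2 PX)
    (hiso : ∀ u : Fin d → ℝ, ∫ x, (∑ k, u k * φ x k) ^ 2 ∂PX = ∑ k, u k ^ 2)
    (h4 : Integrable (fun x => (∑ k, φ x k ^ 2) ^ 2) PX) (A σ : ℝ≥0) (hσ : 0 < σ) (n : ℕ) (c : ℝ)
    {t : (Fin n → 𝒳 × ℝ) → 𝒳 × ℝ → ℝ} (ht : Measurable (Function.uncurry t)) :
    ENNReal.ofReal ((A + σ ^ 2) * (σ ^ 2 / (A + σ ^ 2)) ^ 2 *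
        (2 * c * d - c ^ 2 * (n * d + d + ∫ x, (∑ k, φ x k ^ 2) ^ 2 ∂PX))) ≤
      ⨆ b : Fin d → ℝ, expectedRegret PX (fun x => ∑ k, φ x k * b k) A σ n t := by
  have hφk : ∀ k, Measurable fun x => φ x k := fun k => (measurable_pi_apply k).comp hφ
  set v : ℝ≥0 := A + σ ^ 2 with hv
  set ρ : ℝ := A / (A + σ ^ 2) with hρ
  have hs : (A + σ ^ 2 : ℝ) ≠ 0 := by positivity
  have hκ : (σ ^ 2 / (A + σ ^ 2) : ℝ) = 1 - ρ := by rw [hρ]; field_simp; ring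
  let G : (Fin d → ℝ) → (Fin (n + 1) → 𝒳) × (Fin (n + 1) → ℝ) → ℝ≥0∞ := fun b p =>
    ENNReal.ofReal ((t (fun i => (p.1 i.succ, ∑ k, φ (p.1 i.succ) k * b k + p.2 i.succ))
      (p.1 0, ∑ k, φ (p.1 0) k * b k + p.2 0) - (∑ k, φ (p.1 0) k * b k + ρ * p.2 0)) ^ 2)
  have hG : Measurable (Function.uncurry G) := by
    have h1 : Measurable fun r : (Fin d → ℝ) × (Fin (n + 1) → 𝒳) × (Fin (n + 1) → ℝ) =>
        t (fun i => (r.2.1 i.succ, ∑ k, φ (r.2.1 i.succ) k * r.1 k + r.2.2 i.succ))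
          (r.2.1 0, ∑ k, φ (r.2.1 0) k * r.1 k + r.2.2 0) :=
      ht.comp (f := fun r : (Fin d → ℝ) × (Fin (n + 1) → 𝒳) × (Fin (n + 1) → ℝ) =>
        (fun i : Fin n => (r.2.1 i.succ, ∑ k, φ (r.2.1 i.succ) k * r.1 k + r.2.2 i.succ),
          (r.2.1 0, ∑ k, φ (r.2.1 0) k * r.1 k + r.2.2 0))) (by fun_prop)
    unfold G Function.uncurry
    fun_prop
  have hR : ∀ b : Fin d → ℝ, expectedRegret PX (fun x => ∑ k, φ x k * b k) A σ n t =
      ∫⁻ p, G b p ∂((Measure.pi fun _ : Fin (n + 1) => PX).prod (iidGaussian (Fin (n + 1)) v)) := by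
    intro b
    have hmi : Integrable (fun x => ∑ k, φ x k * b k) PX :=
      integrable_finsetSum _ fun k _ => ((h2 k).integrable (by norm_num)).mul_const _
    rw [expectedRegret_eq_lintegral PX (by fun_prop) hmi A σ hσ n ht]
    have hmp := measurePreserving_arrowProdEquivProdArrow 𝒳 ℝ
      (Fin (n + 1)) (fun _ => PX) (fun _ => gaussianReal 0 v)
    exact hmp.lintegral_comp (hG.comp measurable_prodMk_left)
  -- The supremum dominates the prior average. Prior variance `v`, equal to the noise variance,
  -- makes noise and coefficients one i.i.d. vector.
  have hprior : ∫⁻ b, expectedRegret PX (fun x => ∑ k, φ x k * b k) A σ n t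
      ∂(iidGaussian (Fin d) v) ≤
      ⨆ b : Fin d → ℝ, expectedRegret PX (fun x => ∑ k, φ x k * b k) A σ n t :=
    (lintegral_mono fun b => le_iSup (fun b : Fin d → ℝ =>
      expectedRegret PX (fun x => ∑ k, φ x k * b k) A σ n t) b).trans_eq (by simp)
  refine le_trans ?_ hprior
  simp_rw [hR]
  rw [lintegral_lintegral_swap hG.aemeasurable, hκ]
  refine le_of_le_of_eq ?_ (lintegral_prod _ hG.lintegral_prod_left'.aemeasurable).symm
  refine (lintegral_bayesRisk_bound_ge PX hφ h2 hiso h4 n _ c).trans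
    (lintegral_mono fun X => ?_)
  have hg : Measurable fun y : Fin (n + 1) → ℝ => t (fun i => (X i.succ, y i.succ)) (X 0, y 0) :=
    ht.comp (f := fun y : Fin (n + 1) → ℝ => (fun i : Fin n => (X i.succ, y i.succ), (X 0, y 0)))
      (by fun_prop)
  have := bayesRisk_linearModel_ge n v ρ c (fun j => φ (X j)) hg
  refine le_of_eq_of_le ?_ this
  rw [hv]
  push_cast
  rfl

end LowerBound

/-! ### Gaussian covariates and the limit of the ratio. -/

section GaussianCovariates

open scoped MatrixOrder

variable {d : ℕ}

/-- The fourth moment of the norm of a standard Gaussian vector. -/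
noncomputable def gaussianFourthMoment (d : ℕ) : ℝ :=
  ∫ x : Fin d → ℝ, (∑ k, x k ^ 2) ^ 2 ∂(iidGaussian (Fin d) 1)

theorem multivariateGaussian_zero_eq_map (S : Matrix (Fin d) (Fin d) ℝ) :
    multivariateGaussian 0 S = (iidGaussian (Fin d) 1).map
      fun x => Matrix.toEuclideanCLM (𝕜 := ℝ) (CFC.sqrt S) (WithLp.toLp 2 x) := by
  rw [multivariateGaussian, ← map_pi_eq_stdGaussian, Measure.map_map (by fun_prop) (by fun_prop)]
  simp only [zero_add]
  rfl

theorem integrable_sum_sq_sq_iidGaussian (v : ℝ≥0) :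
    Integrable (fun x : Fin d → ℝ => (∑ k, x k ^ 2) ^ 2) (iidGaussian (Fin d) v) := by
  have h : MemLp (fun x : Fin d → ℝ => ∑ k, x k ^ 2) 2 (iidGaussian (Fin d) v) := by
    refine memLp_finsetSum _ fun k _ => ?_
    have h1 : MemLp (fun y : ℝ => y ^ 2) 2 (gaussianReal 0 v) := by
      refine (memLp_two_iff_integrable_sq (by fun_prop)).2 ?_
      have := (memLp_id_gaussianReal (μ := 0) (v := v) 4).integrable_norm_pow (by norm_num)
      refine this.congr (ae_of_all _ fun y => ?_)
      simp only [id_eq, Real.norm_eq_abs]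
      rw [show y ^ 2 = |y| ^ 2 from (sq_abs y).symm, ← pow_mul]
    exact h1.comp_measurePreserving (measurePreserving_eval (fun _ : Fin d => gaussianReal 0 v) k)
  exact h.integrable_sq

/-- Whitening by the inverse square root of `S` makes the features standard Gaussian without
changing the linear class, so the bound does not depend on `S`. -/
theorem minimaxRegret_singleton_multivariateGaussian_ge {S : Matrix (Fin d) (Fin d) ℝ}
    (hS : S.PosDef) (A σ : ℝ≥0) (hσ : 0 < σ) (n : ℕ) (c : ℝ) :
    ENNReal.ofReal ((A + σ ^ 2) * (σ ^ 2 / (A + σ ^ 2)) ^ 2 *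
        (2 * c * d - c ^ 2 * (n * d + d + gaussianFourthMoment d))) ≤
      minimaxRegret {multivariateGaussian 0 S} (linearClass d) A σ n := by
  set PX := multivariateGaussian 0 S
  set L := Matrix.toEuclideanCLM (𝕜 := ℝ) (CFC.sqrt S)
  set M := Matrix.toEuclideanCLM (𝕜 := ℝ) (CFC.sqrt S)⁻¹
  have hdet : IsUnit (CFC.sqrt S).det := by
    have h : CFC.sqrt S * CFC.sqrt S = S := CFC.sqrt_mul_sqrt_self S hS.posSemidef.nonneg
    have h2 := congrArg Matrix.det h
    rw [Matrix.det_mul] at h2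
    refine isUnit_iff_ne_zero.2 fun h0 => ?_
    rw [h0, zero_mul] at h2
    exact hS.det_pos.ne h2
  have hML : ∀ x, M (L x) = x := by
    intro x
    have : M * L = 1 := by
      rw [← map_mul, Matrix.nonsing_inv_mul _ hdet, map_one]
    exact congrArg (fun f => f x) this
  set φ : EuclideanSpace ℝ (Fin d) → Fin d → ℝ := fun x k => M x k
  have hφ : Measurable φ := by fun_prop
  have hmap : PX = (iidGaussian (Fin d) 1).map fun x => L (WithLp.toLp 2 x) :=
    multivariateGaussian_zero_eq_map S
  have hL : Measurable fun x : Fin d → ℝ => L (WithLp.toLp 2 x) := by fun_prop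
  have hφL : ∀ x : Fin d → ℝ, φ (L (WithLp.toLp 2 x)) = x := by
    intro x
    ext k
    simp only [φ, hML]
  have h2 : ∀ k, MemLp (fun x => φ x k) 2 PX := by
    intro k
    rw [hmap, memLp_map_measure_iff (Measurable.aestronglyMeasurable (by fun_prop))
      hL.aemeasurable]
    simp only [Function.comp_def, hφL]
    exact (memLp_id_gaussianReal 2).comp_measurePreserving
      (measurePreserving_eval (fun _ : Fin d => gaussianReal 0 1) k)
  have hiso : ∀ u : Fin d → ℝ, ∫ x, (∑ k, u k * φ x k) ^ 2 ∂PX = ∑ k, u k ^ 2 := by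
    intro u
    rw [hmap, integral_map hL.aemeasurable (Measurable.aestronglyMeasurable (by fun_prop))]
    simp only [hφL]
    rw [integral_linearForm_sq, NNReal.coe_one, one_mul]
  have h4 : Integrable (fun x => (∑ k, φ x k ^ 2) ^ 2) PX := by
    rw [hmap, integrable_map_measure (Measurable.aestronglyMeasurable (by fun_prop))
      hL.aemeasurable]
    simp only [Function.comp_def, hφL]
    exact integrable_sum_sq_sq_iidGaussian 1
  have hK : ∫ x, (∑ k, φ x k ^ 2) ^ 2 ∂PX = gaussianFourthMoment d := by
    rw [hmap, integral_map hL.aemeasurable (Measurable.aestronglyMeasurable (by fun_prop))]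
    simp only [hφL]
    rfl
  refine le_iInf₂ fun t ht => ?_
  have h := iSup_expectedRegret_ge PX hφ h2 hiso h4 A σ hσ n c ht
  rw [hK] at h
  refine h.trans (iSup_le fun b => ?_)
  -- A linear function of the whitened features is linear in `x`, with coefficient the adjoint of
  -- `M` applied to `b`.
  have hb : (fun x => ∑ k, φ x k * b k) ∈ linearClass d := by
    refine ⟨ContinuousLinearMap.adjoint M (WithLp.toLp 2 b), ?_⟩
    ext x
    rw [ContinuousLinearMap.adjoint_inner_right]
    simp [PiLp.inner_apply, φ, mul_comm]
  exact le_iSup₂_of_le PX (Set.mem_singleton _) (le_iSup₂_of_le _ hb le_rfl)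

/-- The least squares denoiser does not use `S`, so one denoiser serves all covariances at once. -/
theorem minimaxRegret_gaussian_le (d : ℕ) (A σ : ℝ≥0) (hσ : 0 < σ) (n : ℕ) :
    minimaxRegret
      {PX | ∃ S : Matrix (Fin d) (Fin d) ℝ, S.PosDef ∧ PX = multivariateGaussian 0 S}
      (linearClass d) A σ n ≤
      ENNReal.ofReal ((σ ^ 2 / (A + σ ^ 2)) ^ 2 * ((A + σ ^ 2) * d / (n + 1))) := by
  refine iInf₂_le_of_le (leastSquaresDenoiser d A σ n) (measurable_leastSquaresDenoiser d A σ n) ?_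
  refine iSup₂_le fun PX hPX => iSup₂_le fun m hm => ?_
  obtain ⟨S, -, rfl⟩ := hPX
  obtain ⟨β, rfl⟩ := hm
  exact expectedRegret_leastSquaresDenoiser_le _ IsGaussian.integrable_id β A σ hσ n

theorem minimaxRegret_mono_laws {𝒳 : Type*} [MeasurableSpace 𝒳] {l₁ l₂ : Set (Measure 𝒳)}
    (h : l₁ ⊆ l₂) (𝒞 : Set (𝒳 → ℝ)) (A σ : ℝ≥0) (n : ℕ) :
    minimaxRegret l₁ 𝒞 A σ n ≤ minimaxRegret l₂ 𝒞 A σ n :=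
  iInf₂_mono fun _ _ => biSup_mono h

theorem coe_linearRate (d : ℕ) (A σ : ℝ≥0) (n : ℕ) :
    (linearRate d A σ n : ℝ) = (σ ^ 2 / (A + σ ^ 2)) ^ 2 * ((A + σ ^ 2) * d / n) := by
  simp only [linearRate]
  push_cast
  rw [div_pow, add_comm (A : ℝ)]
  ring

theorem tendsto_absLogRatio_of_tendsto_div {a : ℕ → ℝ≥0∞} {b : ℕ → ℝ≥0}
    (h : Tendsto (fun n => a n / (b n : ℝ≥0∞)) atTop (𝓝 1)) :
    Tendsto (fun n => absLogRatio (a n) (b n)) atTop (𝓝 0) := by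
  have h1 : Tendsto (fun n => (a n / (b n : ℝ≥0∞)).toReal) atTop (𝓝 1) :=
    (ENNReal.tendsto_toReal ENNReal.one_ne_top).comp h
  have h2 : Tendsto (fun n => ENNReal.ofReal |Real.log (a n / (b n : ℝ≥0∞)).toReal|) atTop
      (𝓝 0) := by
    have := ENNReal.tendsto_ofReal (h1.log one_ne_zero).abs
    simpa using this
  refine h2.congr' ?_
  filter_upwards [h1.eventually_const_lt zero_lt_one] with n hn
  rw [absLogRatio, ENNReal.log_pos_real' hn, EReal.abs_def]

theorem tendsto_absLogRatio_of_bounds (hd : 1 ≤ d) (A σ : ℝ≥0) (hσ : 0 < σ) {M : ℕ → ℝ≥0∞}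
    (hlow : ∀ (n : ℕ) (c : ℝ), ENNReal.ofReal ((A + σ ^ 2) * (σ ^ 2 / (A + σ ^ 2)) ^ 2 *
        (2 * c * d - c ^ 2 * (n * d + d + gaussianFourthMoment d))) ≤ M n)
    (hup : ∀ n : ℕ, M n ≤
      ENNReal.ofReal ((σ ^ 2 / (A + σ ^ 2)) ^ 2 * ((A + σ ^ 2) * d / (n + 1)))) :
    Tendsto (fun n => absLogRatio (M n) (linearRate d A σ n)) atTop (𝓝 0) := by
  refine tendsto_absLogRatio_of_tendsto_div ?_
  set K : ℝ := (d + gaussianFourthMoment d) / d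
  have hd0 : (0 : ℝ) < d := by exact_mod_cast hd
  have hσ' : (0 : ℝ) < σ := hσ
  have hs : (0 : ℝ) < A + σ ^ 2 := by positivity
  have hpos : ∀ n : ℕ, 1 ≤ n → (0 : ℝ) < linearRate d A σ n := by
    intro n hn
    have hn0 : (0 : ℝ) < n := by exact_mod_cast hn
    rw [coe_linearRate]
    positivity
  have hl : Tendsto (fun n : ℕ => ENNReal.ofReal (1 - K / n)) atTop (𝓝 1) := by
    have := ENNReal.tendsto_ofReal ((tendsto_const_nhds (x := (1 : ℝ))).sub
      (tendsto_const_div_atTop_nhds_zero_nat K))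
    simpa using this
  have hu : Tendsto (fun n : ℕ => ENNReal.ofReal (n / (n + 1))) atTop (𝓝 1) := by
    have := ENNReal.tendsto_ofReal (tendsto_natCast_div_add_atTop (1 : ℝ))
    simpa using this
  refine tendsto_of_tendsto_of_tendsto_of_le_of_le' hl hu ?_ ?_
  · filter_upwards [eventually_ge_atTop 1] with n hn
    have hn0 : (0 : ℝ) < n := by exact_mod_cast hn
    rw [ENNReal.le_div_iff_mul_le (Or.inl (by exact_mod_cast (hpos n hn).ne'))
      (Or.inl ENNReal.coe_ne_top), ← ENNReal.ofReal_coe_nnreal,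
      ← ENNReal.ofReal_mul' (hpos n hn).le]
    -- `c = 1 / n` makes the main term `d / n` and the relative loss `K / n`; it maximizes `2 c d -
    -- c² n d`.
    refine le_of_eq_of_le ?_ (hlow n (1 / n))
    rw [coe_linearRate]
    congr 1
    simp only [K]
    field_simp
    ring
  · filter_upwards [eventually_ge_atTop 1] with n hn
    have hn0 : (0 : ℝ) < n := by exact_mod_cast hn
    refine ENNReal.div_le_of_le_mul ((hup n).trans_eq ?_)
    rw [← ENNReal.ofReal_coe_nnreal, ← ENNReal.ofReal_mul' (hpos n hn).le, coe_linearRate]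
    congr 1
    field_simp

end GaussianCovariates

end FayHerriot

theorem mainTheorem3 :
    ∃ C : ℝ≥0, ∀ (d : ℕ), 1 ≤ d → ∀ (A σ : ℝ≥0), 0 < σ →
      (∀ S : Matrix (Fin d) (Fin d) ℝ, S.PosDef →
        ∃ l : ℝ≥0∞, l ≤ (C : ℝ≥0∞) ∧
          Tendsto (fun n : ℕ => FayHerriot.absLogRatio
            (FayHerriot.minimaxRegret {multivariateGaussian 0 S} (FayHerriot.linearClass d) A σ n)
            (FayHerriot.linearRate d A σ n)) atTop (𝓝 l)) ∧
      (∃ l : ℝ≥0∞, l ≤ (C : ℝ≥0∞) ∧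
        Tendsto (fun n : ℕ => FayHerriot.absLogRatio
          (FayHerriot.minimaxRegret
            {PX | ∃ S : Matrix (Fin d) (Fin d) ℝ, S.PosDef ∧ PX = multivariateGaussian 0 S}
            (FayHerriot.linearClass d) A σ n)
          (FayHerriot.linearRate d A σ n)) atTop (𝓝 l)) := by
  -- The minimax regret is asymptotic to the rate with constant one, so `C = 0` works.
  refine ⟨0, fun d hd A σ hσ => ?_⟩
  have hsub : ∀ S : Matrix (Fin d) (Fin d) ℝ, S.PosDef → {multivariateGaussian 0 S} ⊆
      {PX | ∃ S : Matrix (Fin d) (Fin d) ℝ, S.PosDef ∧ PX = multivariateGaussian 0 S} :=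
    fun S hS => Set.singleton_subset_iff.2 ⟨S, hS, rfl⟩
  refine ⟨fun S hS => ⟨0, zero_le, ?_⟩, 0, zero_le, ?_⟩
  · exact FayHerriot.tendsto_absLogRatio_of_bounds hd A σ hσ
      (FayHerriot.minimaxRegret_singleton_multivariateGaussian_ge hS A σ hσ)
      fun n => (FayHerriot.minimaxRegret_mono_laws (hsub S hS) _ A σ n).trans
        (FayHerriot.minimaxRegret_gaussian_le d A σ hσ n)
  · exact FayHerriot.tendsto_absLogRatio_of_bounds hd A σ hσ
      -- For unknown covariance, the single law with identity covariance already gives the lower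
      -- bound.
      (fun n c => (FayHerriot.minimaxRegret_singleton_multivariateGaussian_ge Matrix.PosDef.one
        A σ hσ n c).trans (FayHerriot.minimaxRegret_mono_laws (hsub 1 Matrix.PosDef.one) _ A σ n))
      (FayHerriot.minimaxRegret_gaussian_le d A σ hσ)
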